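/- Let $\mathfrak X$ be a complex separable Hilbert space and $B(\mathfrak X)$ the bounded linear operators on it. A de Branges operator is a pair $\mathfrak E=(E_-,E_+)$ of entire $B(\mathfrak X)$-valued functions whose values are Fredholm operators (finite-dimensional kernel, closed range of finite codimension), such that $E_+(z)$ is invertible for $\operatorname{Im}z>0$, $E_-(z)$ is invertible for $\operatorname{Im}z<0$, and $S=E_+^{-1}E_-$ is analytic with $\|S(z)\|\le 1$ on the upper half-plane $\mathbb C_+$ and has a boundary function (strong limit) on $\mathbb R$ that is almost everywhere both an isometry and a co-isometry. Its de Branges space $\mathcal B(\mathfrak E)$ is the Hilbert space of $\mathfrak X$-valued entire functions with reproducing kernel $$K_w(z)=\frac{E_+(z)E_+(w)^*-E_-(z)E_-(w)^*}{-2\pi i(z-\overline w)}\quad(z\ne\overline w),\qquad K_w(\overline w)=\frac{E_+'(\overline w)E_+(w)^*-E_-'(\overline w)E_-(w)^*}{-2\pi i};$$ it is also described as the space of entire $f:\mathbb C\to\mathfrak X$ with $E_+^{-1}f\in H^2_{\mathfrak X}(\mathbb C_+)$ and $E_-^{-1}f\in H^2_{\mathfrak X}(\mathbb C_+)^\perp=H^2_{\mathfrak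 X}(\mathbb C_-)$, with norm $\|f\|^2=\int_{\mathbb R}\|E_+(t)^{-1}f(t)\|^2\,dt$. Theorem. For every de Branges operator $\mathfrak E=(E_-,E_+)$ there are an entire function $N:\mathbb C\to B(\mathfrak X)$ and a de Branges operator $\mathfrak E^0=(E_-^0,E_+^0)$ with $$E_+(z)=N(z)E_+^0(z),\qquad E_-(z)=N(z)E_-^0(z)\qquad(z\in\mathbb C)$$ such that: (a) $N$ is a Weierstrass-type product: for some $z_0\in\mathbb R$, points $z_n\in\mathbb C\setminus\{z_0\}$ with $|z_n|\to\infty$ and finite rank orthogonal projections $P_n$ on $\mathfrak X$ ($P_n=0$ is allowed, so that finite products are included), $$N(z)=\lim_{n\to\infty}\prod_{k=1}^{n}\Bigl[I-\tfrac{z-z_0}{z_k-z_0}P_k\Bigr]\exp\Bigl[\sum_{j=1}^{k}\tfrac1j\Bigl(\tfrac{z-z_0}{z_k-z_0}\Bigr)^{j}P_k\Bigr]$$ in operator norm, uniformly on bounded sets, with the factors ordered from left to right; (b) $N(z)$ is invertible except exactly at the real points where $E_+(z)$ is not invertible, and these are also exactly the real points where $E_-(z)$ is not invertible; (c) $E_+^0(x)$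 and $E_-^0(x)$ are invertible for every $x\in\mathbb R$; (d) $N\mathcal B(\mathfrak E^0)$ is contained isometrically in $\mathcal B(\mathfrak E)$: for every $f\in\mathcal B(\mathfrak E^0)$ one has $Nf\in\mathcal B(\mathfrak E)$ and $\|Nf\|_{\mathcal B(\mathfrak E)}=\|f\|_{\mathcal B(\mathfrak E^0)}$. This holds for both descriptions of the de Branges spaces. -/

import Mathlib

open Filter Topology MeasureTheory ContinuousLinearMap

noncomputable section

namespace DeBranges

variable {X : Type*} [NormedAddCommGroup X] [InnerProductSpace ℂ X] [CompleteSpace X]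

/-- `S` belongs to the operator valued Schur class on the open upper half-plane (analytic there with
norm at most one), and its boundary function on the real line, i.e. its strong limit along
vertical lines, is at almost every point both an isometry and a co-isometry. -/
structure IsInnerAndCoinner (S : ℂ → X →L[ℂ] X) : Prop where
  differentiableOn : DifferentiableOn ℂ S {z | 0 < z.im}
  norm_le_one : ∀ z : ℂ, 0 < z.im → ‖S z‖ ≤ 1
  boundary : ∃ Sb : ℝ → X →L[ℂ] X,
    (∀ᵐ x : ℝ, ∀ u : X,
      Tendsto (fun y : ℝ => S (x + y * Complex.I) u) (𝓝[>] 0) (𝓝 (Sb x u))) ∧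
    (∀ᵐ x : ℝ, adjoint (Sb x) * Sb x = 1) ∧
    (∀ᵐ x : ℝ, Sb x * adjoint (Sb x) = 1)

/-- The pair `(Em, Ep)` is a de Branges operator: two entire functions with Fredholm values, `Ep`
invertible on the upper and `Em` on the lower open half-plane, with `Ep⁻¹ Em` inner and
co-inner on the upper half-plane. -/
structure IsDeBrangesOperator (Em Ep : ℂ → X →L[ℂ] X) : Prop where
  differentiable_minus : Differentiable ℂ Em
  differentiable_plus : Differentiable ℂ Ep
  fredholm_minus : ∀ z, (Em z).IsFredholm
  fredholm_plus : ∀ z, (Ep z).IsFredholm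
  isUnit_plus : ∀ z : ℂ, 0 < z.im → IsUnit (Ep z)
  isUnit_minus : ∀ z : ℂ, z.im < 0 → IsUnit (Em z)
  inner : IsInnerAndCoinner fun z => Ring.inverse (Ep z) * Em z

/-- The Hardy space `H²` of `X`-valued analytic functions on the upper half-plane. Only the values
of `F` on that half-plane matter. -/
def MemHardyUpper (F : ℂ → X) : Prop :=
  DifferentiableOn ℂ F {z | 0 < z.im} ∧
    ∃ C : NNReal, ∀ y : ℝ, 0 < y → ∫⁻ x : ℝ, ‖F (x + y * Complex.I)‖ₑ ^ 2 ≤ C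

/-- The Hardy space `H²` of `X`-valued analytic functions on the lower half-plane, which is the
orthogonal complement in `L²(ℝ; X)` of the one on the upper half-plane. -/
def MemHardyLower (F : ℂ → X) : Prop :=
  DifferentiableOn ℂ F {z | z.im < 0} ∧
    ∃ C : NNReal, ∀ y : ℝ, y < 0 → ∫⁻ x : ℝ, ‖F (x + y * Complex.I)‖ₑ ^ 2 ≤ C

/-- The de Branges space of the pair `(Em, Ep)` as a set of entire functions. -/
def space (Em Ep : ℂ → X →L[ℂ] X) : Set (ℂ → X) :=
  {f | Differentiable ℂ f ∧
    MemHardyUpper (fun z => Ring.inverse (Ep z) (f z)) ∧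
    MemHardyLower (fun z => Ring.inverse (Em z) (f z))}

/-- The norm of the de Branges space: `‖f‖² = ∫ ‖Ep(t)⁻¹ f(t)‖² dt` over the real line. -/
def spaceNorm (Ep : ℂ → X →L[ℂ] X) (f : ℂ → X) : ENNReal :=
  eLpNorm (fun t : ℝ => Ring.inverse (Ep t) (f t)) 2 volume

/-- The de Branges kernel `K_w(z)`, as the matrix with row index `z` and column index `w`. -/
def kernel (Em Ep : ℂ → X →L[ℂ] X) : Matrix ℂ ℂ (X →L[ℂ] X) :=
  Matrix.of fun z w =>
    if z = star w then
      (-2 * Real.pi * Complex.I : ℂ)⁻¹ •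
        (deriv Ep (star w) * adjoint (Ep w) - deriv Em (star w) * adjoint (Em w))
    else
      (-2 * Real.pi * Complex.I * (z - star w) : ℂ)⁻¹ •
        (Ep z * adjoint (Ep w) - Em z * adjoint (Em w))

/-- The operator Weierstrass factor
`(I - ζ P) exp (ζ P + ζ² P / 2 + ⋯ + ζⁿ P / n)`. -/
def weierstrassFactor (P : X →L[ℂ] X) (n : ℕ) (ζ : ℂ) : X →L[ℂ] X :=
  (1 - ζ • P) *
    NormedSpace.exp (∑ j ∈ Finset.range n, (ζ ^ (j + 1) / ((j + 1 : ℕ) : ℂ)) • P)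

/-- The ordered product of the first `n` Weierstrass factors, new factors multiplying from the
right; the factor belonging to `a k` and `P k` (with `k` counted from zero) has genus `k + 1`. -/
def weierstrassPartial (z₀ : ℂ) (a : ℕ → ℂ) (P : ℕ → X →L[ℂ] X) : ℕ → ℂ → X →L[ℂ] X
  | 0, _ => 1
  | n + 1, z => weierstrassPartial z₀ a P n z *
      weierstrassFactor (P n) (n + 1) ((z - z₀) / (a n - z₀))

/-- `N` is a Weierstrass product based at `z₀`: the limit, in operator norm and uniformly on bounded
sets, of the ordered partial products of Weierstrass factors attached to finite rank orthogonal
projections `P n` and points `a n ≠ z₀` with `|a n| → ∞`. A projection may be zero, and its factor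
is then `I`, so that finite products are included. -/
def IsWeierstrassProduct (z₀ : ℂ) (N : ℂ → X →L[ℂ] X) : Prop :=
  ∃ (a : ℕ → ℂ) (P : ℕ → X →L[ℂ] X),
    (∀ n, a n ≠ z₀) ∧ Tendsto (fun n => ‖a n‖) atTop atTop ∧
    (∀ n, IsStarProjection (P n) ∧ FiniteDimensional ℂ (P n).range) ∧
    ∀ B : Set ℂ, Bornology.IsBounded B →
      TendstoUniformlyOn (weierstrassPartial z₀ a P) N atTop B

end DeBranges

end

/-!
Let `E` be an entire function with Fredholm values which is invertible at points arbitrarily close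
to each real point. By the analytic Fredholm alternative (`exists_inversePoleLE_of_isFredholm`) its
inverse is meromorphic near the real line, so the real points where `E` is not invertible are
isolated and each of them carries a pole of `E⁻¹` of finite order. If `E a` is not invertible and
`P` is the orthogonal projection onto the finite dimensional space `(ran E a)ᗮ`, then `P * E a = 0`,
so a Weierstrass factor built from `P` and `a` can be split off on the left
(`exists_eq_weierstrassFactor_mul`). This lowers the order of the pole of the inverse at `a` by one
(`InversePoleLE.of_mul_left_succ`) and does not change the orders elsewhere. Hence, if a sequence
`a n → ∞` lists every real zero at least as often as the order of its pole (`exists_seq_le_count`),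
splitting off factors along this sequence leaves quotients that are, from some index on, invertible
at any given real point. The factors are so close to `1` that the partial products and the quotients both
converge uniformly on bounded sets, and that invertibility passes to the limit. This gives
`E = N * E₀` with `E₀` invertible on the real line and `N` invertible off it
(`exists_weierstrassProduct_mul`).

For a de Branges operator this is applied to `Ep`. The inner function `S = Ep⁻¹ * Em` is meromorphic
near the real line and bounded by one above it, hence has no real poles, and its values on the line
are unitary (`IsDeBrangesOperator.exists_analyticAt`). Therefore `N⁻¹ * Em = Ep₀ * S` has no real
poles either, and it is invertible on the real line (`IsDeBrangesOperator.exists_factorization`).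

In the Hardy space picture multiplication by `N` is isometric because `N` cancels in
`Ep⁻¹ * (N f) = Ep₀⁻¹ * f`. In the kernel picture the kernels satisfy `K z w = N z * K₀ z w * (N w)*`
(`kernel_mul`), on the exceptional set `z = star w` because
`Ep₀ z * (Ep₀ (star z))* = Em₀ z * (Em₀ (star z))*` everywhere by analytic continuation from the
real line. So `K₀_w (N w)* u ↦ K_w u` preserves inner products. The kernel functions `K₀_w (N w)* u`
are total since `N w` is invertible for nonreal `w` and the kernel function at a real point is a
limit of those above it.
-/

namespace DeBranges

/-! ### Limits of infinite products -/

section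

/-- A sequence of functions whose successive relative increments are bounded by a summable sequence
from an index on at which it is bounded converges uniformly. It applies to products with factors close to `1`, multiplied on either side. -/
theorem tendstoUniformlyOn_of_norm_sub_le {α A : Type*} [NormedAddCommGroup A] [CompleteSpace A]
    {f : ℕ → α → A} {s : Set α} {c : ℕ → ℝ} {K : ℕ} {M : ℝ} (hc : Summable c)
    (hc0 : ∀ n, 0 ≤ c n)
    (hM : ∀ z ∈ s, ‖f K z‖ ≤ M)
    (hf : ∀ n, K ≤ n → ∀ z ∈ s, ‖f (n + 1) z - f n z‖ ≤ c n * ‖f n z‖) :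
    ∃ g : α → A, TendstoUniformlyOn f g atTop s := by
  have hexp : ∀ n, 1 + c n ≤ Real.exp (c n) := fun n => by
    rw [add_comm]; exact Real.add_one_le_exp _
  have hbound : ∀ n, ∀ z ∈ s, ‖f (K + n) z‖ ≤ M * Real.exp (∑ k ∈ Finset.range n, c (K + k)) := by
    intro n z hz
    induction n with
    | zero => simpa using hM z hz
    | succ n ih =>
      have h1 := hf (K + n) (Nat.le_add_right _ _) z hz
      have h2 : ‖f (K + n + 1) z‖ ≤ ‖f (K + n) z‖ * (1 + c (K + n)) := by
        have := norm_le_norm_add_norm_sub' (f (K + n + 1) z) (f (K + n) z)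
        linarith
      rw [Finset.sum_range_succ, Real.exp_add, ← mul_assoc]
      exact h2.trans (mul_le_mul ih (hexp _) (by linarith [hc0 (K + n)])
        ((norm_nonneg _).trans ih))
  have hcK : Summable fun k => c (K + k) := by
    simpa only [add_comm K] using (summable_nat_add_iff K).2 hc
  set C := M * Real.exp (∑' k, c (K + k)) with hC
  have hbound' : ∀ n, ∀ z ∈ s, ‖f (K + n) z‖ ≤ C := by
    intro n z hz
    refine (hbound n z hz).trans (mul_le_mul_of_nonneg_left (Real.exp_le_exp.2
      (hcK.sum_le_tsum _ fun i _ => hc0 _)) ((norm_nonneg _).trans (hM z hz)))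
  have hsum : Summable fun k => c (K + k) * C := hcK.mul_right C
  have key := tendstoUniformlyOn_tsum_nat (f := fun n z => f (K + n + 1) z - f (K + n) z)
    (s := s) hsum (fun n z hz => (hf (K + n) (Nat.le_add_right _ _) z hz).trans
      (mul_le_mul_of_nonneg_left (hbound' n z hz) (hc0 _)))
  have htel : ∀ n z, ∑ k ∈ Finset.range n, (f (K + k + 1) z - f (K + k) z) = f (K + n) z - f K z :=
    fun n z => Finset.sum_range_sub (fun k => f (K + k) z) n
  simp only [htel] at key
  refine ⟨fun z => f K z + ∑' n, (f (K + n + 1) z - f (K + n) z), ?_⟩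
  rw [Metric.tendstoUniformlyOn_iff] at key ⊢
  intro ε hε
  obtain ⟨n₀, h₀⟩ := eventually_atTop.1 (key ε hε)
  filter_upwards [eventually_ge_atTop (K + n₀)] with n hn z hz
  obtain ⟨m, rfl⟩ := Nat.exists_eq_add_of_le (le_of_add_le_left hn)
  have := h₀ m (by omega) z hz
  rw [dist_eq_norm] at this ⊢
  rwa [show ∀ a b d : A, a + b - d = b - (d - a) by intros; abel]

/-- Uniform limits on all balls glue to one limit function, uniform on all bounded sets. -/
theorem exists_tendstoUniformlyOn_isBounded {A : Type*} [NormedAddCommGroup A]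
    {f : ℕ → ℂ → A} (h : ∀ R : ℝ, ∃ g, TendstoUniformlyOn f g atTop (Metric.closedBall 0 R)) :
    ∃ g, ∀ B : Set ℂ, Bornology.IsBounded B → TendstoUniformlyOn f g atTop B := by
  choose g hg using h
  refine ⟨fun z => g ‖z‖ z, fun B hB => ?_⟩
  obtain ⟨R, hR⟩ := hB.subset_closedBall 0
  refine ((hg R).mono hR).congr_right fun z hz => ?_
  exact tendsto_nhds_unique ((hg R).tendsto_at (hR hz)) ((hg ‖z‖).tendsto_at (by simp))

/-- A limit of units is a unit if the relative increments of the inverses are summable, since then the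
inverses converge as well. -/
theorem isUnit_of_tendsto {A : Type*} [NormedRing A] [CompleteSpace A] {f g : ℕ → A} {a : A}
    (hf : Tendsto f atTop (𝓝 a)) {K : ℕ} {c : ℕ → ℝ} (hc : Summable c) (hc0 : ∀ n, 0 ≤ c n)
    (hfg : ∀ n, K ≤ n → f n * g n = 1) (hgf : ∀ n, K ≤ n → g n * f n = 1)
    (hg : ∀ n, K ≤ n → ‖g (n + 1) - g n‖ ≤ c n * ‖g n‖) : IsUnit a := by
  obtain ⟨b, hb⟩ := tendstoUniformlyOn_of_norm_sub_le (f := fun n (_ : Unit) => g n)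
    (s := Set.univ) (M := ‖g K‖) hc hc0 (fun _ _ => le_rfl) (fun n hn _ _ => hg n hn)
  have hb' : Tendsto g atTop (𝓝 (b ())) := hb.tendsto_at (Set.mem_univ _)
  refine ⟨⟨a, b (), ?_, ?_⟩, rfl⟩
  · refine tendsto_nhds_unique (hf.mul hb') (tendsto_const_nhds.congr' ?_)
    filter_upwards [eventually_ge_atTop K] with n hn using (hfg n hn).symm
  · refine tendsto_nhds_unique (hb'.mul hf) (tendsto_const_nhds.congr' ?_)
    filter_upwards [eventually_ge_atTop K] with n hn using (hgf n hn).symm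

theorem differentiable_of_tendstoUniformlyOn {A : Type*} [NormedAddCommGroup A] [NormedSpace ℂ A]
    [CompleteSpace A] {f : ℕ → ℂ → A} {g : ℂ → A}
    (h : ∀ B : Set ℂ, Bornology.IsBounded B → TendstoUniformlyOn f g atTop B)
    (hf : ∀ n, Differentiable ℂ (f n)) : Differentiable ℂ g := by
  rw [← differentiableOn_univ]
  refine TendstoLocallyUniformlyOn.differentiableOn (φ := atTop) (F := f) ?_
    (Eventually.of_forall fun n => (hf n).differentiableOn) isOpen_univ
  rw [tendstoLocallyUniformlyOn_iff_forall_isCompact isOpen_univ]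
  exact fun K _ hK => h K hK.isBounded

/-! ### Weierstrass factors -/

variable {X : Type*} [NormedAddCommGroup X] [InnerProductSpace ℂ X] [CompleteSpace X]

/-- The scalar Weierstrass elementary factor `(1 - ζ) exp (ζ + ζ² / 2 + ⋯ + ζⁿ / n)`. -/
noncomputable def elementaryFactor (n : ℕ) (ζ : ℂ) : ℂ :=
  (1 - ζ) * Complex.exp (∑ j ∈ Finset.range n, ζ ^ (j + 1) / ((j + 1 : ℕ) : ℂ))

theorem exp_smul_of_isIdempotentElem {A : Type*} [NormedRing A] [NormedAlgebra ℂ A]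
    [CompleteSpace A] {P : A} (hP : IsIdempotentElem P) (s : ℂ) :
    NormedSpace.exp (s • P) = 1 - P + Complex.exp s • P := by
  have hpow : ∀ n : ℕ, P ^ (n + 1) = P := fun n => hP.pow_succ_eq n
  have h1 : HasSum (fun n : ℕ => ((n.factorial : ℂ)⁻¹) • s ^ n) (NormedSpace.exp s) :=
    NormedSpace.exp_series_hasSum_exp' s
  rw [← Complex.exp_eq_exp_ℂ] at h1
  have h2 := (h1.smul_const P)
  have h3 : HasSum (fun n : ℕ => if n = 0 then 1 - P else 0) (1 - P) := hasSum_ite_eq 0 (1 - P)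
  have h4 := h3.add h2
  have h5 := NormedSpace.exp_series_hasSum_exp' (𝕂 := ℂ) (s • P)
  refine h5.unique (h4.congr_fun ?_)
  intro n
  cases n with
  | zero => simp
  | succ n => simp [smul_pow, hpow, smul_smul]

/-- A Weierstrass factor acts as the scalar elementary factor on the range of `P` and as the identity on
its kernel. -/
theorem weierstrassFactor_eq {P : X →L[ℂ] X} (hP : IsIdempotentElem P) (n : ℕ) (ζ : ℂ) :
    weierstrassFactor P n ζ = 1 - P + elementaryFactor n ζ • P := by
  rw [weierstrassFactor, ← Finset.sum_smul, exp_smul_of_isIdempotentElem hP, elementaryFactor]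
  have : P * P = P := hP
  simp only [mul_add, sub_mul, mul_sub, one_mul, mul_one, smul_mul_assoc, mul_smul_comm, this]
  module

theorem norm_elementaryFactor_sub_one_le (n : ℕ) {ζ : ℂ} (hζ : ‖ζ‖ ≤ 1 / 2) :
    ‖elementaryFactor n ζ - 1‖ ≤ 4 * ‖ζ‖ ^ (n + 1) := by
  have hlt : ‖-ζ‖ < 1 := by rw [norm_neg]; linarith
  have h := Complex.norm_log_sub_logTaylor_le n hlt
  have htay : Complex.logTaylor (n + 1) (-ζ) =
      -∑ j ∈ Finset.range n, ζ ^ (j + 1) / ((j + 1 : ℕ) : ℂ) := by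
    rw [Complex.logTaylor, Finset.sum_range_succ']
    simp only [Nat.cast_zero, div_zero, add_zero]
    rw [← Finset.sum_neg_distrib]
    refine Finset.sum_congr rfl fun j _ => ?_
    rw [← neg_div, show (-1 : ℂ) ^ (j + 1 + 1) * (-ζ) ^ (j + 1) = -ζ ^ (j + 1) by
      rw [neg_pow ζ, ← mul_assoc, ← pow_add, Odd.neg_one_pow (by exact ⟨j + 1, by ring⟩)]; ring]
  rw [htay, sub_neg_eq_add, ← sub_eq_add_neg] at h
  set w := Complex.log (1 - ζ) + ∑ j ∈ Finset.range n, ζ ^ (j + 1) / ((j + 1 : ℕ) : ℂ) with hw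
  have hne : (1 : ℂ) - ζ ≠ 0 := by
    intro h0
    have : ζ = 1 := (sub_eq_zero.1 h0).symm
    rw [this] at hζ; norm_num at hζ
  have hE : elementaryFactor n ζ = Complex.exp w := by
    rw [hw, Complex.exp_add, Complex.exp_log hne, elementaryFactor]
  have hw2 : ‖w‖ ≤ 2 * ‖ζ‖ ^ (n + 1) := by
    refine h.trans ?_
    rw [norm_neg]
    have h1 : (1 - ‖ζ‖)⁻¹ ≤ 2 := by
      rw [inv_le_comm₀ (by linarith) (by norm_num)]; linarith
    have h2 : (1 : ℝ) ≤ (n : ℝ) + 1 := by linarith [n.cast_nonneg (α := ℝ)]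
    calc ‖ζ‖ ^ (n + 1) * (1 - ‖ζ‖)⁻¹ / (n + 1) ≤ ‖ζ‖ ^ (n + 1) * (1 - ‖ζ‖)⁻¹ :=
          div_le_self (mul_nonneg (by positivity) (inv_nonneg.2 (by linarith))) h2
      _ ≤ ‖ζ‖ ^ (n + 1) * 2 := by gcongr
      _ = _ := by ring
  have hw1 : ‖w‖ ≤ 1 := by
    have : ‖ζ‖ ^ (n + 1) ≤ 1 / 2 := by
      calc ‖ζ‖ ^ (n + 1) ≤ ‖ζ‖ ^ 1 := pow_le_pow_of_le_one (norm_nonneg _) (by linarith) (by omega)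
        _ ≤ _ := by simpa using hζ
    linarith
  rw [hE]
  have := Complex.norm_exp_sub_one_le hw1
  linarith

theorem norm_weierstrassFactor_sub_one_le {P : X →L[ℂ] X} (hP : IsStarProjection P) (n : ℕ)
    {ζ : ℂ} (hζ : ‖ζ‖ ≤ 1 / 2) : ‖weierstrassFactor P n ζ - 1‖ ≤ 4 * ‖ζ‖ ^ (n + 1) := by
  rw [weierstrassFactor_eq hP.isIdempotentElem,
    show 1 - P + elementaryFactor n ζ • P - 1 = (elementaryFactor n ζ - 1) • P by
      rw [sub_smul, one_smul]; abel, norm_smul]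
  calc _ ≤ (4 * ‖ζ‖ ^ (n + 1)) * 1 := by
        gcongr
        · exact norm_elementaryFactor_sub_one_le n hζ
        · exact hP.norm_le
    _ = _ := mul_one _

theorem elementaryFactor_eq_zero_iff {n : ℕ} {ζ : ℂ} : elementaryFactor n ζ = 0 ↔ ζ = 1 := by
  simp only [elementaryFactor, mul_eq_zero, Complex.exp_ne_zero, or_false, sub_eq_zero]
  exact eq_comm

theorem weierstrassFactor_mul_inv {P : X →L[ℂ] X} (hP : IsIdempotentElem P) {n : ℕ} {ζ : ℂ}
    (hζ : elementaryFactor n ζ ≠ 0) :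
    weierstrassFactor P n ζ * (1 - P + (elementaryFactor n ζ)⁻¹ • P) = 1 ∧
      (1 - P + (elementaryFactor n ζ)⁻¹ • P) * weierstrassFactor P n ζ = 1 := by
  have hPP : P * P = P := hP
  rw [weierstrassFactor_eq hP]
  constructor <;>
  simp [mul_add, add_mul, sub_mul, mul_sub, hPP, smul_smul, hζ]

theorem isUnit_weierstrassFactor {P : X →L[ℂ] X} (hP : IsIdempotentElem P) {n : ℕ} {ζ : ℂ}
    (hζ : ζ ≠ 1) : IsUnit (weierstrassFactor P n ζ) :=
  have h := weierstrassFactor_mul_inv hP (n := n) (mt elementaryFactor_eq_zero_iff.1 hζ)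
  ⟨⟨_, _, h.1, h.2⟩, rfl⟩

theorem norm_ringInverse_sub_one_le {A : Type*} [NormedRing A] {u : A} (hu : IsUnit u)
    {c : ℝ} (h : ‖u - 1‖ ≤ c) (hc : c ≤ 1 / 2) :
    ‖Ring.inverse u - 1‖ ≤ 2 * c := by
  have e : Ring.inverse u - 1 = -((Ring.inverse u - 1) * (u - 1)) - (u - 1) := by
    have := Ring.inverse_mul_cancel u hu
    simp only [sub_mul, mul_sub, this, mul_one, one_mul]; abel
  have h2 : ‖Ring.inverse u - 1‖ ≤ ‖Ring.inverse u - 1‖ * c + c := by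
    calc ‖Ring.inverse u - 1‖ = ‖-((Ring.inverse u - 1) * (u - 1)) - (u - 1)‖ := by rw [← e]
      _ ≤ ‖Ring.inverse u - 1‖ * ‖u - 1‖ + ‖u - 1‖ := by
          refine (norm_sub_le _ _).trans ?_
          rw [norm_neg]; gcongr; exact norm_mul_le _ _
      _ ≤ _ := by gcongr
  nlinarith [norm_nonneg (Ring.inverse u - 1)]

end

section

/-! ### Poles of the inverse of an analytic family -/

/-- The inverse of the family `E` has a pole of order at most `m` at `x`: near `x` one has
`E z⁻¹ = (z - x)⁻ᵐ • H z` with `H` analytic. Stated without division, so that `z = x` is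
included. -/
def InversePoleLE {A : Type*} [NormedRing A] [NormedAlgebra ℂ A] (E : ℂ → A) (x : ℂ) (m : ℕ) :
    Prop :=
  ∃ H : ℂ → A, AnalyticAt ℂ H x ∧
    ∀ᶠ z in 𝓝 x, H z * E z = (z - x) ^ m • (1 : A) ∧ E z * H z = (z - x) ^ m • (1 : A)

section Algebra

variable {A : Type*} [NormedRing A] [NormedAlgebra ℂ A]

theorem InversePoleLE.isUnit {E : ℂ → A} {x : ℂ} (h : InversePoleLE E x 0) : IsUnit (E x) := by
  obtain ⟨H, -, h⟩ := h
  have := h.self_of_nhds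
  simp only [pow_zero, one_smul] at this
  exact ⟨⟨_, _, this.2, this.1⟩, rfl⟩

theorem InversePoleLE.eventually_isUnit {E : ℂ → A} {x : ℂ} {m : ℕ} (h : InversePoleLE E x m) :
    ∀ᶠ z in 𝓝[≠] x, IsUnit (E z) := by
  obtain ⟨H, -, h⟩ := h
  filter_upwards [h.filter_mono nhdsWithin_le_nhds, self_mem_nhdsWithin] with z hz hne
  have h0 : (z - x) ^ m ≠ 0 := pow_ne_zero _ (sub_ne_zero.2 hne)
  refine ⟨⟨_, ((z - x) ^ m)⁻¹ • H z, ?_, ?_⟩, rfl⟩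
  · rw [mul_smul_comm, hz.2, smul_smul, inv_mul_cancel₀ h0, one_smul]
  · rw [smul_mul_assoc, hz.1, smul_smul, inv_mul_cancel₀ h0, one_smul]

theorem inversePoleLE_zero [CompleteSpace A] {E : ℂ → A} {x : ℂ} (hE : AnalyticAt ℂ E x)
    (hu : IsUnit (E x)) : InversePoleLE E x 0 := by
  obtain ⟨u, hu'⟩ := hu
  refine ⟨fun z => Ring.inverse (E z), ?_, ?_⟩
  · exact AnalyticAt.comp (hu' ▸ analyticAt_inverse u) hE
  · have : ∀ᶠ z in 𝓝 x, IsUnit (E z) :=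
      hE.continuousAt.eventually (Units.isOpen.mem_nhds ⟨u, hu'⟩)
    filter_upwards [this] with z hz
    simp [Ring.inverse_mul_cancel _ hz, Ring.mul_inverse_cancel _ hz]

theorem InversePoleLE.of_mul_left {E F G : ℂ → A} {x : ℂ} {m : ℕ} (h : InversePoleLE E x m)
    (hF : AnalyticAt ℂ F x) (hu : ∀ᶠ z in 𝓝 x, IsUnit (F z)) (hE : ∀ z, E z = F z * G z) :
    InversePoleLE G x m := by
  obtain ⟨H, hH, h⟩ := h
  refine ⟨fun z => H z * F z, hH.mul hF, ?_⟩
  filter_upwards [h, hu] with z hz hu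
  refine ⟨by rw [mul_assoc, ← hE, hz.1], hu.mul_left_cancel ?_⟩
  rw [← mul_assoc, ← hE, ← mul_assoc, hz.2, smul_mul_assoc, mul_smul_comm, one_mul, mul_one]

theorem analyticAt_dslope [CompleteSpace A] {f : ℂ → A} {x : ℂ} (hf : AnalyticAt ℂ f x) :
    AnalyticAt ℂ (dslope f x) x := by
  obtain ⟨p, hp⟩ := hf
  exact ⟨_, hp.has_fpower_series_dslope_fslope⟩

/-- Dividing a family on the left by a factor that vanishes at `x` on everything missed by the range
lowers the order of the pole of the inverse: since `H x * E x = 0`, also `H x * F x = 0`, so that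
`H * F` can be divided by `z - x`. -/
theorem InversePoleLE.of_mul_left_succ [CompleteSpace A] {E F G : ℂ → A} {x : ℂ} {m : ℕ}
    (h : InversePoleLE E x (m + 1)) (hF : AnalyticAt ℂ F x) (hG : ContinuousAt G x)
    (hu : ∀ᶠ z in 𝓝[≠] x, IsUnit (F z)) (hE : ∀ z, E z = F z * G z)
    (hker : ∀ T : A, T * E x = 0 → T * F x = 0) :
    InversePoleLE G x m := by
  obtain ⟨H, hH, h⟩ := h
  have h0 : H x * F x = 0 := hker _ (by simpa using h.self_of_nhds.1)
  have hHF : AnalyticAt ℂ (fun z => H z * F z) x := hH.mul hF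
  have hD := analyticAt_dslope hHF
  have hdiv : ∀ z, (z - x) • dslope (fun z => H z * F z) x z = H z * F z := fun z => by
    rw [sub_smul_dslope, h0, sub_zero]
  have hpow : ContinuousAt (fun z : ℂ => (z - x) ^ m • (1 : A)) x := by fun_prop
  refine ⟨dslope (fun z => H z * F z) x, hD, Eventually.and ?_ ?_⟩
  · refine ((hD.continuousAt.mul hG).eventuallyEq_nhds_iff_eventuallyEq_nhdsNE hpow).1 ?_
    filter_upwards [h.filter_mono nhdsWithin_le_nhds, self_mem_nhdsWithin] with z hz hne
    have hne' : z - x ≠ 0 := sub_ne_zero.2 hne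
    refine smul_right_injective A hne' ?_
    simp only [Pi.mul_apply]
    rw [← smul_mul_assoc, hdiv, mul_assoc, ← hE, hz.1, pow_succ', smul_smul]
  · refine ((hG.mul hD.continuousAt).eventuallyEq_nhds_iff_eventuallyEq_nhdsNE hpow).1 ?_
    filter_upwards [h.filter_mono nhdsWithin_le_nhds, self_mem_nhdsWithin, hu] with z hz hne hu
    have hne' : z - x ≠ 0 := sub_ne_zero.2 hne
    refine smul_right_injective A hne' (hu.mul_left_cancel ?_)
    simp only [Pi.mul_apply]
    rw [← mul_smul_comm, hdiv, ← mul_assoc, ← hE, ← mul_assoc, hz.2, smul_smul, ← pow_succ',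
      smul_mul_assoc, mul_smul_comm, one_mul, mul_one]

end Algebra

/-! ### Analytic families of Fredholm operators -/

section Matrix

variable {n : Type*} [Fintype n] [DecidableEq n]

theorem analyticAt_det {M : ℂ → Matrix n n ℂ} {x : ℂ}
    (h : ∀ i j, AnalyticAt ℂ (fun z => M z i j) x) : AnalyticAt ℂ (fun z => (M z).det) x := by
  simp only [Matrix.det_apply']
  refine Finset.analyticAt_fun_sum _ fun σ _ => ?_
  exact analyticAt_const.mul (Finset.analyticAt_fun_prod _ fun i _ => h _ _)

theorem analyticAt_adjugate {M : ℂ → Matrix n n ℂ} {x : ℂ}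
    (h : ∀ i j, AnalyticAt ℂ (fun z => M z i j) x) (i j : n) :
    AnalyticAt ℂ (fun z => (M z).adjugate i j) x := by
  simp only [Matrix.adjugate_apply]
  refine analyticAt_det fun k l => ?_
  by_cases hk : k = j
  · subst hk; simpa using analyticAt_const
  · simpa [Matrix.updateRow_ne hk] using h k l

end Matrix

/-- In finite dimension the inverse of a generically injective analytic family is the adjugate divided
by the determinant, hence meromorphic. -/
theorem exists_inversePoleLE_of_finiteDimensional {V : Type*} [NormedAddCommGroup V]
    [NormedSpace ℂ V] [FiniteDimensional ℂ V] {T : ℂ → V →L[ℂ] V} {x : ℂ}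
    (hT : AnalyticAt ℂ T x) (hinj : ∃ᶠ z in 𝓝 x, Function.Injective (T z)) :
    ∃ m, InversePoleLE T x m := by
  classical
  let b := Module.finBasis ℂ V
  let M : ℂ → Matrix _ _ ℂ := fun z => LinearMap.toMatrix b b (T z : V →ₗ[ℂ] V)
  have hM : ∀ i j, AnalyticAt ℂ (fun z => M z i j) x := by
    intro i j
    have : (fun z => M z i j) = fun z =>
        (LinearMap.toContinuousLinearMap (b.coord i)) (ContinuousLinearMap.apply ℂ V (b j) (T z)) := by
      ext z; simp [M, LinearMap.toMatrix_apply]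
    rw [this]
    exact (ContinuousLinearMap.analyticAt _ _).comp ((ContinuousLinearMap.analyticAt _ _).comp hT)
  have hdet := analyticAt_det hM
  have hnz : ¬ ∀ᶠ z in 𝓝 x, (M z).det = 0 := by
    intro h0
    obtain ⟨z, hz, hz0⟩ := (hinj.and_eventually h0).exists
    rw [LinearMap.det_toMatrix] at hz0
    have : (T z : V →ₗ[ℂ] V).ker = ⊥ := LinearMap.ker_eq_bot.2 hz
    exact (LinearMap.isUnit_iff_ker_eq_bot _).2 this |> LinearMap.isUnit_det _ |>.ne_zero hz0
  obtain ⟨m, g, hg, hg0, hev⟩ := hdet.exists_eventuallyEq_pow_smul_nonzero_iff.2 hnz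
  let Ψ : Matrix _ _ ℂ →ₗ[ℂ] (V →L[ℂ] V) :=
    (LinearMap.toContinuousLinearMap : (V →ₗ[ℂ] V) ≃ₗ[ℂ] (V →L[ℂ] V)).toLinearMap ∘ₗ
      (Matrix.toLin b b).toLinearMap
  have hΨM : ∀ z, Ψ (M z) = T z := by intro z; ext v; simp [Ψ, M]
  have hΨmul : ∀ B C, Ψ (B * C) = Ψ B * Ψ C := by
    intro B C; ext v; simp [Ψ, Matrix.toLin_mul b b b]
  have hΨ1 : Ψ 1 = 1 := by ext v; simp [Ψ]
  have hadj : AnalyticAt ℂ (fun z => Ψ ((M z).adjugate)) x := by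
    have : (fun z => Ψ ((M z).adjugate)) = fun z =>
        ∑ i, ∑ j, (M z).adjugate i j • Ψ (Matrix.single i j 1) := by
      ext1 z
      conv_lhs => rw [Matrix.matrix_eq_sum_single ((M z).adjugate)]
      simp only [map_sum, ← map_smul, Matrix.smul_single, smul_eq_mul, mul_one]
    rw [this]
    exact Finset.analyticAt_fun_sum _ fun i _ => Finset.analyticAt_fun_sum _ fun j _ =>
      (analyticAt_adjugate hM i j).smul analyticAt_const
  refine ⟨m, fun z => (g z)⁻¹ • Ψ ((M z).adjugate), (hg.inv hg0).smul hadj, ?_⟩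
  filter_upwards [hev, hg.continuousAt.eventually_ne hg0] with z hz hgz
  have e : (g z)⁻¹ • (M z).det • (1 : V →L[ℂ] V) = (z - x) ^ m • 1 := by
    rw [hz, smul_smul, smul_eq_mul]; congr 1; field_simp
  rw [← e, ← hΨM]
  constructor
  · rw [smul_mul_assoc, ← hΨmul, Matrix.adjugate_mul, map_smul, hΨ1]
  · rw [mul_smul_comm, ← hΨmul, Matrix.mul_adjugate, map_smul, hΨ1]

variable {X : Type*} [NormedAddCommGroup X] [InnerProductSpace ℂ X]

open scoped LinearMap.FiniteRangeSetoid in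
/-- The Fredholm property is stable under perturbations of finite rank. -/
theorem isFredholm_of_hasFiniteRange_sub {T S : X →L[ℂ] X} (hT : T.IsFredholm)
    (h : ((S : X →ₗ[ℂ] X) - T).HasFiniteRange) : S.IsFredholm := by
  obtain ⟨v, hv⟩ := hT.exists_isQuasiInverse
  exact IsFredholm.of_isQuasiInverse (v := v)
    (hv.congr (Setoid.refl _) (LinearMap.FiniteRangeSetoid.equiv_iff_hasFiniteRange.2 h))

open scoped LinearMap.FiniteRangeSetoid in
theorem isFredholm_of_isUnit {T : X →L[ℂ] X} (hT : IsUnit T) : T.IsFredholm := by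
  obtain ⟨u, rfl⟩ := hT
  refine IsFredholm.of_isQuasiInverse (v := (↑u⁻¹ : X →L[ℂ] X)) ⟨?_, ?_⟩
  · have : ((↑u⁻¹ : X →L[ℂ] X) : X →ₗ[ℂ] X) ∘ₗ ((u : X →L[ℂ] X) : X →ₗ[ℂ] X) = LinearMap.id := by
      ext v; exact congr($(u.inv_mul) v)
    rw [LinearMap.IsLeftQuasiInverse, this]
  · have : ((u : X →L[ℂ] X) : X →ₗ[ℂ] X) ∘ₗ ((↑u⁻¹ : X →L[ℂ] X) : X →ₗ[ℂ] X) = LinearMap.id := by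
      ext v; exact congr($(u.mul_inv) v)
    rw [LinearMap.IsRightQuasiInverse, this]

theorem isFredholm_mul {T S : X →L[ℂ] X} (hT : T.IsFredholm) (hS : S.IsFredholm) :
    (T * S).IsFredholm := by
  obtain ⟨v, hv⟩ := hT.exists_isQuasiInverse
  obtain ⟨w, hw⟩ := hS.exists_isQuasiInverse
  exact IsFredholm.of_isQuasiInverse (v := w * v) (hw.comp hv)

variable [CompleteSpace X]

open scoped LinearMap.FiniteRangeSetoid in
/-- The analytic Fredholm alternative: near a point where an analytic family of operators is
Fredholm and which is a limit of points of invertibility, the inverse is meromorphic. A nearby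
invertible value supplies an invertible `w` with `w * E x - 1` of finite rank; a Schur complement
then reduces the claim to Cramer's rule on a finite dimensional space. -/
theorem exists_inversePoleLE_of_isFredholm {E : ℂ → X →L[ℂ] X} {x : ℂ} (hE : AnalyticAt ℂ E x)
    (hfr : (E x).IsFredholm) (hu : ∃ᶠ z in 𝓝 x, IsUnit (E z)) : ∃ m, InversePoleLE E x m := by
  obtain ⟨v, hv, -⟩ := hfr.exists_isQuasiInverse
  set p : X →L[ℂ] X := 1 - v * E x with hp
  have hfin : FiniteDimensional ℂ p.range := by
    have h1 := (LinearMap.FiniteRangeSetoid.equiv_iff_hasFiniteRange.1 (Setoid.symm hv))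
    have : (p : X →ₗ[ℂ] X) = LinearMap.id - (v : X →ₗ[ℂ] X) ∘ₗ (E x : X →ₗ[ℂ] X) := by
      ext y; simp [hp]
    rw [← this] at h1
    exact Module.Finite.of_fg h1
  have hev1 : ∀ᶠ z in 𝓝 x, IsUnit (1 + v * (E z - E x)) := by
    have : ContinuousAt (fun z => 1 + v * (E z - E x)) x := by
      have := hE.continuousAt; fun_prop
    exact this.eventually (Units.isOpen.mem_nhds (by simp))
  obtain ⟨z₁, ⟨B, hB⟩, ⟨u, hu₁⟩⟩ := (hu.and_eventually hev1).exists
  -- `w = v + p * B⁻¹` differs from the quasi-inverse `v` by an operator of finite rank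
  set w : (X →L[ℂ] X)ˣ := u * B⁻¹ with hw
  set k : X →L[ℂ] X := 1 - ↑B⁻¹ * E x with hk
  have hwE : (w : X →L[ℂ] X) * E x = 1 - p * k := by
    have hwv : (w : X →L[ℂ] X) = v + p * ↑B⁻¹ := by
      rw [hw, Units.val_mul, hu₁, ← hB, hp]
      have : v * (B : X →L[ℂ] X) * ↑B⁻¹ = v := by rw [mul_assoc, Units.mul_inv, mul_one]
      simp only [add_mul, sub_mul, mul_sub, one_mul, this]
      abel
    rw [hwv, hk, add_mul, mul_sub, mul_one, mul_assoc, hp]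
    abel
  set U : ℂ → X →L[ℂ] X := fun z => 1 + w * (E z - E x) with hU
  have hUa : AnalyticAt ℂ U x :=
    analyticAt_const.add (analyticAt_const.mul (hE.sub analyticAt_const))
  have hUu : ∀ᶠ z in 𝓝 x, IsUnit (U z) :=
    hUa.continuousAt.eventually (Units.isOpen.mem_nhds (by simp [hU]))
  have hUE : ∀ z, w * E z = U z - p * k := fun z => by
    simp only [hU, mul_sub, hwE]; abel
  have hUi : AnalyticAt ℂ (fun z => Ring.inverse (U z)) x := by
    have h1 : U x = ((1 : (X →L[ℂ] X)ˣ) : X →L[ℂ] X) := by simp [hU]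
    exact AnalyticAt.comp (h1 ▸ analyticAt_inverse 1) hUa
  let V := p.range
  let π : X →L[ℂ] V := p.rangeRestrict
  let ι : V →L[ℂ] X := V.subtypeL
  have hιπ : ∀ y, ι (π y) = p y := fun y => rfl
  let a : ℂ → V →L[ℂ] X := fun z => Ring.inverse (U z) ∘L ι
  let b : X →L[ℂ] V := π ∘L k
  have ha : AnalyticAt ℂ a x :=
    ((ContinuousLinearMap.compL ℂ V X X).flip ι).analyticAt _ |>.comp hUi
  -- `1 - a b` is invertible exactly when `1 - b a` is, and the latter acts on a finite dimensional
  -- space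
  let T : ℂ → V →L[ℂ] V := fun z => 1 - b ∘L a z
  have hT : AnalyticAt ℂ T x :=
    analyticAt_const.sub (((ContinuousLinearMap.compL ℂ V X V b).analyticAt _).comp ha)
  have hfac : ∀ z, IsUnit (U z) → Ring.inverse (U z) * w * E z = 1 - a z ∘L b := by
    intro z hz
    rw [mul_assoc, hUE, mul_sub, Ring.inverse_mul_cancel _ hz]
    rfl
  have hinj : ∃ᶠ z in 𝓝 x, Function.Injective (T z) := by
    refine (hu.and_eventually hUu).mono fun z ⟨hz, hUz⟩ => ?_
    rw [injective_iff_map_eq_zero]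
    intro y hy
    have hy1 : y = b (a z y) := by simpa [T, sub_eq_zero] using hy
    have hun : IsUnit (Ring.inverse (U z) * w * E z) :=
      ((isUnit_ringInverse.2 hUz).mul w.isUnit).mul hz
    have h0 : (Ring.inverse (U z) * w * E z) (a z y) = 0 := by
      rw [hfac z hUz]; simp [← hy1]
    obtain ⟨q, hq⟩ := hun
    have h2 : a z y = 0 := by
      have := congr($(q.inv_mul) (a z y))
      rw [hq] at this
      simpa [h0] using this.symm
    rw [hy1, h2, map_zero]
  obtain ⟨m, L, hL, hLT⟩ := exists_inversePoleLE_of_finiteDimensional hT hinj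
  have hK : AnalyticAt ℂ (fun z => (z - x) ^ m • (1 : X →L[ℂ] X) + a z ∘L (L z ∘L b)) x := by
    have h1 : AnalyticAt ℂ (fun z => L z ∘L b) x :=
      ((ContinuousLinearMap.compL ℂ X V V).flip b).analyticAt _ |>.comp hL
    have h2 : AnalyticAt ℂ (fun z => a z ∘L (L z ∘L b)) x := by
      have := ((ContinuousLinearMap.compL ℂ X V X).analyticAt_bilinear (a x, L x ∘L b)).comp₂ ha h1
      exact this
    exact (((analyticAt_id.sub analyticAt_const).pow m).smul analyticAt_const).add h2
  refine ⟨m, fun z => ((z - x) ^ m • (1 : X →L[ℂ] X) + a z ∘L (L z ∘L b)) *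
    (Ring.inverse (U z) * w), hK.mul (hUi.mul analyticAt_const), ?_⟩
  filter_upwards [hLT, hUu] with z hz hUz
  have e1 : ∀ y, L z y - L z (b (a z y)) = (z - x) ^ m • y := fun y => by
    simpa [T] using congr($(hz.1) y)
  have e2 : ∀ y, L z y - b (a z (L z y)) = (z - x) ^ m • y := fun y => by
    simpa [T] using congr($(hz.2) y)
  constructor
  · rw [mul_assoc, hfac z hUz]
    ext y
    have := congr(a z $(e1 (b y)))
    simp only [map_sub, map_smul] at this
    simp [smul_sub, ← this]
  · have hun : IsUnit (Ring.inverse (U z) * w) := (isUnit_ringInverse.2 hUz).mul w.isUnit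
    refine hun.mul_left_cancel ?_
    rw [← mul_assoc, ← mul_assoc, hfac z hUz, mul_smul_comm, mul_one]
    have : (1 - a z ∘L b) * ((z - x) ^ m • (1 : X →L[ℂ] X) + a z ∘L (L z ∘L b)) =
        (z - x) ^ m • 1 := by
      ext y
      have := congr(a z $(e2 (b y)))
      simp only [map_sub, map_smul] at this
      simp [← this]
    rw [this, smul_mul_assoc, one_mul]

end

section

theorem ringInverse_mul {A : Type*} [MonoidWithZero A] {x y : A} (hx : IsUnit x) (hy : IsUnit y) :
    Ring.inverse (x * y) = Ring.inverse y * Ring.inverse x := by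
  obtain ⟨u, rfl⟩ := hx
  obtain ⟨v, rfl⟩ := hy
  rw [← Units.val_mul, Ring.inverse_unit, Ring.inverse_unit, Ring.inverse_unit, mul_inv_rev,
    Units.val_mul]

/-! ### Enumerating the real zeros -/

/-- A locally finite multiset of real numbers, given by its multiplicities, is exhausted by a
sequence that tends to infinity in absolute value and avoids a given point outside the multiset. -/
theorem exists_seq_le_count (m : ℝ → ℕ) (hm : ∀ R : ℝ, {x | m x ≠ 0 ∧ |x| ≤ R}.Finite) {z₀ : ℝ}
    (hz₀ : m z₀ = 0) :
    ∃ a : ℕ → ℝ, (∀ n, a n ≠ z₀) ∧ Tendsto (fun n => |a n|) atTop atTop ∧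
      ∀ x, ∃ n, m x ≤ Nat.count (fun k => a k = x) n := by
  let I : Set (ℝ × ℕ) := {p | p.2 < m p.1}
  have hIR : ∀ R : ℝ, {p ∈ I | |p.1| ≤ R}.Finite := by
    intro R
    refine ((hm R).biUnion fun x _ =>
      ((Set.finite_singleton x).prod (Set.finite_lt_nat (m x)))).subset ?_
    rintro ⟨x, i⟩ ⟨hi, hx⟩
    have hi' : i < m x := hi
    simp only [Set.mem_iUnion]
    exact ⟨x, ⟨by omega, hx⟩, rfl, hi'⟩
  have hIc : I.Countable := by
    have : I = ⋃ R : ℕ, {p ∈ I | |p.1| ≤ R} := by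
      ext p
      simp only [Set.mem_iUnion, Set.mem_ofPred_eq]
      exact ⟨fun h => (exists_nat_ge |p.1|).imp fun _ hn => ⟨h, hn⟩, fun ⟨_, h, _⟩ => h⟩
    rw [this]
    exact Set.countable_iUnion fun R => (hIR R).countable
  have := hIc.to_subtype
  -- the second summand makes the index type infinite, so that the sequence never stops
  obtain ⟨hden⟩ := nonempty_denumerable (I ⊕ ℕ)
  let e : ℕ ≃ I ⊕ ℕ := (Denumerable.eqv (I ⊕ ℕ)).symm
  let v : I ⊕ ℕ → ℝ := Sum.elim (fun p => p.1.1) (fun j => z₀ + 1 + j)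
  refine ⟨fun n => v (e n), fun n => ?_, ?_, fun x => ?_⟩
  · show v (e n) ≠ z₀
    rcases e n with ⟨p, hp⟩ | j
    · rintro h
      have hp' : p.2 < m p.1 := hp
      have : p.1 = z₀ := h
      rw [this, hz₀] at hp'
      omega
    · have : (0 : ℝ) ≤ j := j.cast_nonneg
      intro h
      have h' : z₀ + 1 + j = z₀ := h
      linarith
  · rw [← Nat.cofinite_eq_atTop]
    have hv : Tendsto (fun i => |v i|) cofinite atTop := by
      rw [tendsto_atTop]
      intro R
      rw [eventually_cofinite]
      have h1 : {p : I | |p.1.1| ≤ R}.Finite :=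
        Set.Finite.of_finite_image ((hIR R).subset (by
          rintro _ ⟨p, hp, rfl⟩; exact ⟨p.2, hp⟩)) Subtype.val_injective.injOn
      have h2 : {j : ℕ | |z₀ + 1 + j| ≤ R}.Finite := by
        refine (Set.finite_le_nat ⌈R + |z₀ + 1|⌉₊).subset fun j hj => ?_
        have hj' : |z₀ + 1 + j| ≤ R := hj
        have : (j : ℝ) ≤ R + |z₀ + 1| := by
          have h3 := abs_le.1 hj'
          have h4 := neg_abs_le (z₀ + 1)
          linarith
        exact_mod_cast this.trans (Nat.le_ceil _)
      refine ((h1.image Sum.inl).union (h2.image Sum.inr)).subset ?_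
      rintro (p | j) h
      · exact Or.inl ⟨p, le_of_lt (not_le.1 h), rfl⟩
      · exact Or.inr ⟨j, le_of_lt (not_le.1 h), rfl⟩
    exact hv.comp e.injective.tendsto_cofinite
  · let g : Fin (m x) → ℕ := fun i => e.symm (Sum.inl ⟨(x, i), i.2⟩)
    have hg : Function.Injective g := by
      intro i j hij
      have := e.symm.injective hij
      simpa [Fin.ext_iff] using this
    refine ⟨Finset.univ.sup g + 1, ?_⟩
    rw [Nat.count_eq_card_filter_range]
    calc m x = (Finset.univ.image g).card := by
          rw [Finset.card_image_of_injective _ hg, Finset.card_univ, Fintype.card_fin]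
      _ ≤ _ := Finset.card_le_card fun k hk => by
          obtain ⟨i, -, rfl⟩ := Finset.mem_image.1 hk
          rw [Finset.mem_filter, Finset.mem_range]
          exact ⟨Nat.lt_succ_of_le (Finset.le_sup (Finset.mem_univ i)), by simp [g, v]⟩

/-- A property that fails near each point, except possibly at the point itself, holds at finitely many
points of each bounded set. -/
theorem finite_setOf_abs_le_of_forall_eventually {p : ℝ → Prop}
    (h : ∀ x, ∀ᶠ t in 𝓝[≠] x, ¬ p t) (R : ℝ) : {x | p x ∧ |x| ≤ R}.Finite := by
  by_contra hinf
  obtain ⟨x, -, hx⟩ := Set.Infinite.exists_accPt_of_subset_isCompact (K := Set.Icc (-R) R) hinf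
    isCompact_Icc fun t ht => abs_le.1 ht.2
  rw [accPt_iff_frequently_nhdsNE] at hx
  obtain ⟨t, ht, hpt⟩ := (hx.and_eventually (h x)).exists
  exact hpt ht.1

theorem tendsto_ofReal_nhdsNE (x : ℝ) : Tendsto ((↑) : ℝ → ℂ) (𝓝[≠] x) (𝓝[≠] (x : ℂ)) :=
  tendsto_nhdsWithin_of_tendsto_nhds_of_eventually_within _
    (Complex.continuous_ofReal.continuousAt.tendsto.mono_left nhdsWithin_le_nhds)
    (by filter_upwards [self_mem_nhdsWithin] with t ht; simpa using ht)

/-! ### Splitting off one factor -/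

variable {X : Type*} [NormedAddCommGroup X] [InnerProductSpace ℂ X] [CompleteSpace X]

theorem differentiable_elementaryFactor (n : ℕ) : Differentiable ℂ (elementaryFactor n) := by
  unfold elementaryFactor; fun_prop

theorem differentiable_weierstrassFactor {P : X →L[ℂ] X} (hP : IsIdempotentElem P) (n : ℕ)
    (a z₀ : ℂ) : Differentiable ℂ fun z => weierstrassFactor P n ((z - z₀) / (a - z₀)) := by
  simp only [weierstrassFactor_eq hP]
  have h := (differentiable_elementaryFactor n).comp
    (show Differentiable ℂ fun z : ℂ => (z - z₀) / (a - z₀) by fun_prop)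
  exact (differentiable_const _).add (h.smul_const P)

omit [CompleteSpace X] in
theorem finiteDimensional_orthogonal_range {T : X →L[ℂ] X} (hT : T.IsFredholm) :
    FiniteDimensional ℂ T.rangeᗮ := by
  have hfin : FiniteDimensional ℂ (X ⧸ T.range) := hT.finite_coker
  refine Module.Finite.of_injective (T.range.mkQ ∘ₗ T.rangeᗮ.subtype) ?_
  rw [← LinearMap.ker_eq_bot, LinearMap.ker_comp, Submodule.ker_mkQ, Submodule.eq_bot_iff]
  rintro ⟨y, hy⟩ hy'
  have : y ∈ T.range := hy'
  ext
  exact inner_self_eq_zero.1 (Submodule.inner_right_of_mem_orthogonal this hy)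

/-- One Weierstrass factor at `a` can be split off from an entire Fredholm valued function; the
projection is the one onto the orthogonal complement of the range of `E a`. -/
theorem exists_eq_weierstrassFactor_mul {E : ℂ → X →L[ℂ] X} (hE : Differentiable ℂ E)
    (hfr : ∀ z, (E z).IsFredholm) {a z₀ : ℂ} (ha : a ≠ z₀) (n : ℕ) :
    ∃ (P : X →L[ℂ] X) (G : ℂ → X →L[ℂ] X), IsStarProjection P ∧ FiniteDimensional ℂ P.range ∧
      Differentiable ℂ G ∧ (∀ z, (G z).IsFredholm) ∧
      (∀ z, E z = weierstrassFactor P n ((z - z₀) / (a - z₀)) * G z) ∧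
      ∀ x m, InversePoleLE E x m → InversePoleLE G x (if x = a then m - 1 else m) := by
  have haz : a - z₀ ≠ 0 := sub_ne_zero.2 ha
  have hclosed : IsClosed ((E a).range : Set X) := (hfr a).isClosed_range
  have : CompleteSpace (E a).range := hclosed.completeSpace_coe
  set P : X →L[ℂ] X := (E a).rangeᗮ.starProjection with hPdef
  have hP : IsStarProjection P := isStarProjection_starProjection
  have hPi : IsIdempotentElem P := hP.isIdempotentElem
  have hPP : P * P = P := hPi
  have hfin := finiteDimensional_orthogonal_range (hfr a)
  have hPrange : P.range = (E a).rangeᗮ := Submodule.range_starProjection _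
  have hPfin : FiniteDimensional ℂ P.range := by rw [hPrange]; exact hfin
  have hPc : 1 - P = (E a).range.starProjection := by
    rw [hPdef, Submodule.starProjection_orthogonal']; abel
  have hPE : P * E a = 0 := by
    have : (1 - P) * E a = E a := by
      ext y
      rw [hPc]
      exact Submodule.starProjection_eq_self_iff.2 ⟨y, rfl⟩
    rw [sub_mul, one_mul, sub_eq_self] at this
    exact this
  have hker : ∀ T : X →L[ℂ] X, T * E a = 0 → T * (1 - P) = 0 := by
    intro T hT
    ext y
    rw [hPc]
    obtain ⟨u, hu⟩ := (E a).range.starProjection_apply_mem y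
    have := congr($hT u)
    change T ((E a).range.starProjection y) = 0
    rw [← hu]
    exact this
  set e : ℂ → ℂ := fun z => elementaryFactor n ((z - z₀) / (a - z₀)) with he
  -- on the range of `P` the quotient is `P * E z / e z`, and `e z * c z = z - a` makes it entire
  set c : ℂ → ℂ := fun z => -(a - z₀) * Complex.exp
    (-∑ j ∈ Finset.range n, ((z - z₀) / (a - z₀)) ^ (j + 1) / ((j + 1 : ℕ) : ℂ)) with hc
  have hec : ∀ z, e z * c z = z - a := by
    intro z
    simp only [he, hc, elementaryFactor, Complex.exp_neg]
    field_simp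
    ring
  have hFE : ∀ z, weierstrassFactor P n ((z - z₀) / (a - z₀)) = 1 - P + e z • P :=
    fun z => weierstrassFactor_eq hPi n _
  set G : ℂ → X →L[ℂ] X := fun z => (1 - P) * E z + c z • (P * dslope E a z) with hG
  have hGd : Differentiable ℂ G := by
    have hd : Differentiable ℂ (dslope E a) := by
      rw [← differentiableOn_univ] at hE ⊢
      exact (Complex.differentiableOn_dslope univ_mem).2 hE
    have hcd : Differentiable ℂ c := by fun_prop
    exact ((differentiable_const _).mul hE).add (hcd.smul ((differentiable_const _).mul hd))
  have hfac : ∀ z, E z = weierstrassFactor P n ((z - z₀) / (a - z₀)) * G z := by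
    intro z
    have h1 : (z - a) • (P * dslope E a z) = P * E z := by
      rw [← mul_smul_comm, sub_smul_dslope, mul_sub, hPE, sub_zero]
    have hQ : (1 - P) * (1 - P) = 1 - P := hPi.one_sub
    have hQP : (1 - P) * P = 0 := by rw [sub_mul, one_mul, hPP, sub_self]
    have hPQ : P * (1 - P) = 0 := by rw [mul_sub, mul_one, hPP, sub_self]
    rw [hFE, hG]
    simp only [add_mul, mul_add, smul_mul_assoc, mul_smul_comm, ← mul_assoc, hQ, hQP, hPQ, hPP,
      smul_zero, add_zero, zero_add, smul_smul]
    rw [mul_comm (c z), hec, h1, sub_mul, one_mul, sub_add_cancel]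
  have hunit : ∀ z, z ≠ a → IsUnit (weierstrassFactor P n ((z - z₀) / (a - z₀))) := by
    intro z hz
    refine isUnit_weierstrassFactor hPi fun h => hz ?_
    rw [div_eq_one_iff_eq haz] at h
    exact sub_left_injective h
  have hFan : ∀ x, AnalyticAt ℂ (fun z => weierstrassFactor P n ((z - z₀) / (a - z₀))) x :=
    fun x => (differentiable_weierstrassFactor hPi n a z₀).analyticAt x
  refine ⟨P, G, hP, hPfin, hGd, fun z => ?_, hfac, fun x m hm => ?_⟩
  · refine isFredholm_of_hasFiniteRange_sub (hfr z) ?_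
    have h1 : (G z : X →ₗ[ℂ] X) - E z = (P : X →ₗ[ℂ] X) ∘ₗ ((1 - e z) • (G z : X →ₗ[ℂ] X)) := by
      ext y
      have h2 := congr($(hfac z) y)
      rw [hFE] at h2
      have h3 : E z y = G z y - P (G z y) + e z • P (G z y) := h2
      change G z y - E z y = P ((1 - e z) • G z y)
      rw [h3, map_smul, sub_smul, one_smul]
      abel
    rw [h1]
    refine LinearMap.HasFiniteRange.comp_right ?_ _
    exact Module.Finite.iff_fg.1 hPfin
  · split_ifs with hx
    · subst hx
      cases m with
      | zero =>
        have htop : (E x).range = ⊤ := by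
          obtain ⟨u, hu⟩ := hm.isUnit
          rw [LinearMap.range_eq_top]
          intro y
          refine ⟨(↑u⁻¹ : X →L[ℂ] X) y, ?_⟩
          have := congr($(u.mul_inv) y)
          rw [hu] at this
          exact this
        have hP0 : P = 0 := by
          have : (1 - P) = 1 := by
            rw [hPc]; ext y
            exact Submodule.starProjection_eq_self_iff.2 (htop ▸ Submodule.mem_top)
          rwa [sub_eq_self] at this
        have : G = E := by
          ext1 z
          rw [hfac z, hFE, hP0]; simp
        rw [this]
        exact hm
      | succ m =>
        refine hm.of_mul_left_succ (hFan x) hGd.continuous.continuousAt ?_ hfac ?_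
        · filter_upwards [self_mem_nhdsWithin] with z hz using hunit z hz
        · intro T hT
          have he0 : e x = 0 := elementaryFactor_eq_zero_iff.2 (div_self haz)
          simp only [hFE, he0, zero_smul, add_zero]
          exact hker T hT
    · refine hm.of_mul_left (hFan x) ?_ hfac
      filter_upwards [eventually_ne_nhds hx] with z hz using hunit z hz

end

section

/-! ### The Weierstrass product of the real zeros -/

variable {X : Type*} [NormedAddCommGroup X] [InnerProductSpace ℂ X] [CompleteSpace X]

/-- Removal of the real zeros of a Fredholm valued entire function by a Weierstrass product. -/
theorem exists_weierstrassProduct_mul {E : ℂ → X →L[ℂ] X} (hE : Differentiable ℂ E)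
    (hfr : ∀ z, (E z).IsFredholm) (hu : ∀ x : ℝ, ∃ᶠ z in 𝓝 (x : ℂ), IsUnit (E z)) :
    ∃ N E₀ : ℂ → X →L[ℂ] X, Differentiable ℂ N ∧ Differentiable ℂ E₀ ∧
      (∃ z₀ : ℝ, IsWeierstrassProduct (z₀ : ℂ) N) ∧ (∀ z : ℂ, z.im ≠ 0 → IsUnit (N z)) ∧
      (∀ z, E z = N z * E₀ z) ∧ ∀ x : ℝ, IsUnit (E₀ x) := by
  classical
  have hord : ∀ x : ℝ, ∃ m, InversePoleLE E x m ∧ (IsUnit (E x) → m = 0) := by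
    intro x
    by_cases h : IsUnit (E x)
    · exact ⟨0, inversePoleLE_zero (hE.analyticAt x) h, fun _ => rfl⟩
    · obtain ⟨m, hm⟩ := exists_inversePoleLE_of_isFredholm (hE.analyticAt x) (hfr x) (hu x)
      exact ⟨m, hm, fun h' => absurd h' h⟩
  choose m hm hm0 using hord
  have hisol : ∀ x : ℝ, ∀ᶠ t : ℝ in 𝓝[≠] x, IsUnit (E t) := fun x =>
    (tendsto_ofReal_nhdsNE x).eventually (hm x).eventually_isUnit
  obtain ⟨z₀, hz₀⟩ := (hisol 0).exists
  obtain ⟨a, haz, hainf, hcount⟩ := exists_seq_le_count m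
    (finite_setOf_abs_le_of_forall_eventually fun x => by
      filter_upwards [hisol x] with t ht using fun h => h (hm0 t ht)) (hm0 z₀ hz₀)
  have haz' : ∀ n, (a n : ℂ) ≠ z₀ := fun n h => haz n (Complex.ofReal_injective h)
  -- the factors are split off one after the other
  have hstep : ∀ (E : {E : ℂ → X →L[ℂ] X // Differentiable ℂ E ∧ ∀ z, (E z).IsFredholm}) (n : ℕ),
      ∃ (P : X →L[ℂ] X)
        (G : {E : ℂ → X →L[ℂ] X // Differentiable ℂ E ∧ ∀ z, (E z).IsFredholm}),
        IsStarProjection P ∧ FiniteDimensional ℂ P.range ∧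
        (∀ z, E.1 z = weierstrassFactor P (n + 1) ((z - z₀) / (a n - z₀)) * G.1 z) ∧
        ∀ x m, InversePoleLE E.1 x m → InversePoleLE G.1 x (if x = a n then m - 1 else m) := by
    intro E n
    obtain ⟨P, G, h1, h2, h3, h4, h5, h6⟩ :=
      exists_eq_weierstrassFactor_mul E.2.1 E.2.2 (haz' n) (n + 1)
    exact ⟨P, ⟨G, h3, h4⟩, h1, h2, h5, h6⟩
  choose P' G' hstar hfin hfac hpole using hstep
  let Es : ℕ → {E : ℂ → X →L[ℂ] X // Differentiable ℂ E ∧ ∀ z, (E z).IsFredholm} :=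
    fun n => Nat.rec ⟨E, hE, hfr⟩ (fun n E => G' E n) n
  let P : ℕ → X →L[ℂ] X := fun n => P' (Es n) n
  have hP : ∀ n, IsStarProjection (P n) := fun n => hstar _ _
  have hPfin : ∀ n, FiniteDimensional ℂ (P n).range := fun n => hfin _ _
  let F : ℕ → ℂ → X →L[ℂ] X :=
    fun n z => weierstrassFactor (P n) (n + 1) ((z - z₀) / (a n - z₀))
  have hEF : ∀ n z, (Es n).1 z = F n z * (Es (n + 1)).1 z := fun n z => hfac _ _ z
  have hNs : ∀ n z, weierstrassPartial z₀ (fun n => a n) P (n + 1) z =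
      weierstrassPartial z₀ (fun n => a n) P n z * F n z := fun n z => rfl
  have hNE : ∀ n z, E z = weierstrassPartial z₀ (fun n => a n) P n z * (Es n).1 z := by
    intro n z
    induction n with
    | zero => exact (one_mul _).symm
    | succ n ih => rw [hNs, mul_assoc, ← hEF, ih]
  have hFd : ∀ n, Differentiable ℂ (F n) := fun n =>
    differentiable_weierstrassFactor (hP n).isIdempotentElem _ _ _
  have hNd : ∀ n, Differentiable ℂ (weierstrassPartial z₀ (fun n => a n) P n) := by
    intro n
    induction n with
    | zero => exact differentiable_const _
    | succ n ih => exact ih.mul (hFd n)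
  have hEpole : ∀ (x : ℝ) n, InversePoleLE (Es n).1 x (m x - Nat.count (fun k => a k = x) n) := by
    intro x n
    induction n with
    | zero => rw [Nat.count_zero]; exact hm x
    | succ n ih =>
      have := hpole (Es n) n _ _ ih
      rw [Nat.count_succ]
      by_cases h : a n = x
      · simpa [h, Nat.sub_sub] using this
      · have h' : (x : ℂ) ≠ a n := fun h' => h (Complex.ofReal_injective h'.symm)
        simpa [h, h'] using this
  -- uniform smallness of the factors with large index
  -- `F n` is within `(1 / 2) ^ n` of `1`, and the factor `2` is for the inverses
  let c : ℕ → ℝ := fun n => 2 * (1 / 2 : ℝ) ^ n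
  have hc : Summable c := (summable_geometric_of_lt_one (by norm_num) (by norm_num)).mul_left 2
  have hc0 : ∀ n, 0 ≤ c n := fun n => by positivity
  have hsmall : ∀ R : ℝ, ∃ K, ∀ n, K ≤ n → ∀ z : ℂ, ‖z‖ ≤ R →
      ‖F n z - 1‖ ≤ c n ∧ IsUnit (F n z) ∧ ‖Ring.inverse (F n z) - 1‖ ≤ c n := by
    intro R
    obtain ⟨K, hK⟩ := eventually_atTop.1
      ((tendsto_atTop.1 hainf (2 * (R + |z₀|) + |z₀| + 1)).and (eventually_ge_atTop 1))
    refine ⟨K, fun n hn z hz => ?_⟩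
    obtain ⟨h1, h2⟩ := hK n hn
    have hd : 2 * (R + |z₀|) + 1 ≤ ‖(a n : ℂ) - z₀‖ := by
      rw [← Complex.ofReal_sub, Complex.norm_real, Real.norm_eq_abs]
      linarith [abs_sub_abs_le_abs_sub (a n) z₀]
    have hζ : ‖(z - z₀) / (a n - z₀)‖ ≤ 1 / 2 := by
      have hR : 0 ≤ R := (norm_nonneg z).trans hz
      rw [norm_div, div_le_iff₀ (by linarith [abs_nonneg z₀])]
      have := norm_sub_le z (z₀ : ℂ)
      rw [Complex.norm_real, Real.norm_eq_abs] at this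
      linarith
    have hF1 : ‖F n z - 1‖ ≤ (1 / 2) ^ n := by
      refine (norm_weierstrassFactor_sub_one_le (hP n) (n + 1) hζ).trans ?_
      calc 4 * ‖(z - z₀) / (a n - z₀)‖ ^ (n + 1 + 1) ≤ 4 * (1 / 2) ^ (n + 1 + 1) := by gcongr
        _ = (1 / 2) ^ n := by ring
    have hFu : IsUnit (F n z) := isUnit_weierstrassFactor (hP n).isIdempotentElem (by
      intro h; rw [h] at hζ; norm_num at hζ)
    refine ⟨hF1.trans ?_, hFu, norm_ringInverse_sub_one_le hFu hF1 ?_⟩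
    · have : (0 : ℝ) ≤ (1 / 2) ^ n := by positivity
      simp only [c]; linarith
    · calc (1 / 2 : ℝ) ^ n ≤ (1 / 2) ^ 1 :=
            pow_le_pow_of_le_one (by norm_num) (by norm_num) h2
        _ = 1 / 2 := pow_one _
  have hbdd : ∀ (f : ℂ → X →L[ℂ] X), Differentiable ℂ f → ∀ R : ℝ,
      ∃ M, ∀ z ∈ Metric.closedBall (0 : ℂ) R, ‖f z‖ ≤ M := fun f hf R =>
    (isCompact_closedBall 0 R).exists_bound_of_continuousOn hf.continuous.continuousOn
  obtain ⟨N, hN⟩ := exists_tendstoUniformlyOn_isBounded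
    (f := weierstrassPartial z₀ (fun n => a n) P) fun R => by
      obtain ⟨K, hK⟩ := hsmall R
      obtain ⟨M, hM⟩ := hbdd _ (hNd K) R
      refine tendstoUniformlyOn_of_norm_sub_le hc hc0 hM fun n hn z hz => ?_
      rw [hNs, ← mul_sub_one, mul_comm (c n)]
      exact (norm_mul_le _ _).trans (mul_le_mul_of_nonneg_left
        (hK n hn z (mem_closedBall_zero_iff.1 hz)).1 (norm_nonneg _))
  obtain ⟨E₀, hE₀⟩ := exists_tendstoUniformlyOn_isBounded (f := fun n => (Es n).1) fun R => by
      obtain ⟨K, hK⟩ := hsmall R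
      obtain ⟨M, hM⟩ := hbdd _ (Es K).2.1 R
      refine tendstoUniformlyOn_of_norm_sub_le hc hc0 hM fun n hn z hz => ?_
      obtain ⟨-, h2, h3⟩ := hK n hn z (mem_closedBall_zero_iff.1 hz)
      have : (Es (n + 1)).1 z = Ring.inverse (F n z) * (Es n).1 z := by
        rw [hEF, ← mul_assoc, Ring.inverse_mul_cancel _ h2, one_mul]
      rw [this, ← sub_one_mul]
      exact (norm_mul_le _ _).trans (mul_le_mul_of_nonneg_right h3 (norm_nonneg _))
  have hNt : ∀ z, Tendsto (fun n => weierstrassPartial z₀ (fun n => a n) P n z) atTop (𝓝 (N z)) :=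
    fun z => (hN {z} Bornology.isBounded_singleton).tendsto_at rfl
  have hEt : ∀ z, Tendsto (fun n => (Es n).1 z) atTop (𝓝 (E₀ z)) :=
    fun z => (hE₀ {z} Bornology.isBounded_singleton).tendsto_at rfl
  refine ⟨N, E₀, differentiable_of_tendstoUniformlyOn hN hNd,
    differentiable_of_tendstoUniformlyOn hE₀ fun n => (Es n).2.1,
    ⟨z₀, fun n => a n, P, haz', ?_, fun n => ⟨hP n, hPfin n⟩, hN⟩, fun z hz => ?_, fun z => ?_,
    fun x => ?_⟩
  · simpa [Complex.norm_real] using hainf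
  · obtain ⟨K, hK⟩ := hsmall ‖z‖
    have hFu : ∀ n, IsUnit (F n z) := fun n => by
      refine isUnit_weierstrassFactor (hP n).isIdempotentElem fun h => hz ?_
      rw [div_eq_one_iff_eq (sub_ne_zero.2 (haz' n))] at h
      rw [sub_left_injective h, Complex.ofReal_im]
    have hNu : ∀ n, IsUnit (weierstrassPartial z₀ (fun n => a n) P n z) := by
      intro n
      induction n with
      | zero => exact isUnit_one
      | succ n ih => exact ih.mul (hFu n)
    refine isUnit_of_tendsto (hNt z) (K := K)
      (g := fun n => Ring.inverse (weierstrassPartial z₀ (fun n => a n) P n z)) hc hc0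
      (fun n _ => Ring.mul_inverse_cancel _ (hNu n))
      (fun n _ => Ring.inverse_mul_cancel _ (hNu n)) fun n hn => ?_
    rw [hNs, ringInverse_mul (hNu n) (hFu n), ← sub_one_mul]
    exact (norm_mul_le _ _).trans (mul_le_mul_of_nonneg_right (hK n hn z le_rfl).2.2
      (norm_nonneg _))
  · refine tendsto_nhds_unique (tendsto_const_nhds.congr fun n => hNE n z) ((hNt z).mul (hEt z))
  · obtain ⟨K, hK⟩ := hsmall ‖(x : ℂ)‖
    obtain ⟨n₀, hn₀⟩ := hcount x
    have hEu : ∀ n, n₀ ≤ n → IsUnit ((Es n).1 x) := fun n hn => by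
      have := hEpole x n
      rw [Nat.sub_eq_zero_of_le (hn₀.trans (Nat.count_monotone _ hn))] at this
      exact this.isUnit
    refine isUnit_of_tendsto (hEt x) (K := max K n₀)
      (g := fun n => Ring.inverse ((Es n).1 x)) hc hc0
      (fun n hn => Ring.mul_inverse_cancel _ (hEu n (le_of_max_le_right hn)))
      (fun n hn => Ring.inverse_mul_cancel _ (hEu n (le_of_max_le_right hn))) fun n hn => ?_
    obtain ⟨h1, h2, -⟩ := hK n (le_of_max_le_left hn) x le_rfl
    have h3 := hEu (n + 1) ((le_of_max_le_right hn).trans (Nat.le_succ n))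
    have : Ring.inverse ((Es (n + 1)).1 x) = Ring.inverse ((Es n).1 x) * F n x := by
      rw [hEF n, ringInverse_mul h2 h3, mul_assoc, Ring.inverse_mul_cancel _ h2, mul_one]
    rw [this, ← mul_sub_one, mul_comm (c n)]
    exact (norm_mul_le _ _).trans (mul_le_mul_of_nonneg_left h1 (norm_nonneg _))

end

section

/-! ### The boundary values of the inner function -/

theorem tendsto_vertical (x : ℝ) :
    Tendsto (fun y : ℝ => (x : ℂ) + y * Complex.I) (𝓝[>] 0) (𝓝[{z | 0 < z.im}] (x : ℂ)) := by
  refine tendsto_nhdsWithin_iff.2 ⟨?_, ?_⟩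
  · have : ContinuousAt (fun y : ℝ => (x : ℂ) + y * Complex.I) 0 := by fun_prop
    simpa [ContinuousAt] using this.tendsto.mono_left (nhdsWithin_le_nhds (s := Set.Ioi 0))
  · filter_upwards [self_mem_nhdsWithin] with y hy
    simpa using hy

instance neBot_nhdsWithin_upper (x : ℝ) : (𝓝[{z : ℂ | 0 < z.im}] (x : ℂ)).NeBot :=
  (tendsto_vertical x).neBot

/-- An analytic function that is `O(|z - x|ᵐ)` from above a real point `x` is divisible by
`(z - x)ᵐ`. -/
theorem exists_eq_pow_smul_of_norm_le {A : Type*} [NormedRing A] [NormedAlgebra ℂ A]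
    [CompleteSpace A] {x : ℝ} (m : ℕ) {Q : ℂ → A} (hQ : AnalyticAt ℂ Q x)
    (hle : ∀ᶠ z in 𝓝[{z : ℂ | 0 < z.im}] (x : ℂ), ‖Q z‖ ≤ ‖z - x‖ ^ m) :
    ∃ S : ℂ → A, AnalyticAt ℂ S x ∧ ∀ z, Q z = (z - x) ^ m • S z := by
  induction m generalizing Q with
  | zero => exact ⟨Q, hQ, by simp⟩
  | succ m ih =>
    have hx : Q x = 0 := by
      have h1 : Tendsto (fun z => ‖Q z‖) (𝓝[{z : ℂ | 0 < z.im}] (x : ℂ)) (𝓝 ‖Q x‖) :=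
        hQ.continuousAt.norm.tendsto.mono_left nhdsWithin_le_nhds
      have h2 : Tendsto (fun z : ℂ => ‖z - x‖ ^ (m + 1)) (𝓝[{z : ℂ | 0 < z.im}] (x : ℂ))
          (𝓝 0) := by
        have : ContinuousAt (fun z : ℂ => ‖z - x‖ ^ (m + 1)) x := by fun_prop
        simpa [ContinuousAt] using this.tendsto.mono_left
          (nhdsWithin_le_nhds (s := {z : ℂ | 0 < z.im}))
      exact norm_le_zero_iff.1 (le_of_tendsto_of_tendsto h1 h2 hle)
    have hdiv : ∀ z, Q z = (z - x) • dslope Q x z := fun z => by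
      rw [sub_smul_dslope, hx, sub_zero]
    obtain ⟨S, hS, h⟩ := ih (analyticAt_dslope hQ) (by
      filter_upwards [hle, self_mem_nhdsWithin] with z hz him
      have hne : 0 < ‖z - x‖ := by
        rw [norm_pos_iff, sub_ne_zero]
        rintro rfl
        simp at him
      rw [hdiv, norm_smul, pow_succ'] at hz
      exact le_of_mul_le_mul_left hz hne)
    exact ⟨S, hS, fun z => by rw [hdiv, h, smul_smul, pow_succ']⟩

variable {X : Type*} [NormedAddCommGroup X] [InnerProductSpace ℂ X] [CompleteSpace X]

theorem IsDeBrangesOperator.exists_inversePoleLE {Em Ep : ℂ → X →L[ℂ] X}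
    (hE : IsDeBrangesOperator Em Ep) (x : ℝ) : ∃ m, InversePoleLE Ep x m := by
  refine exists_inversePoleLE_of_isFredholm (hE.differentiable_plus.analyticAt x)
    (hE.fredholm_plus x) ?_
  have : ∃ᶠ z in 𝓝[{z : ℂ | 0 < z.im}] (x : ℂ), IsUnit (Ep z) := Eventually.frequently (by
    filter_upwards [self_mem_nhdsWithin] with z hz using hE.isUnit_plus z hz)
  exact this.filter_mono nhdsWithin_le_nhds

/-- The inner function `Ep⁻¹ Em` continues analytically across the real line, since its possible
poles there are excluded by boundedness, and its values on the real line are unitary. -/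
theorem IsDeBrangesOperator.exists_analyticAt {Em Ep : ℂ → X →L[ℂ] X}
    (hE : IsDeBrangesOperator Em Ep) (x : ℝ) :
    ∃ S : ℂ → X →L[ℂ] X, AnalyticAt ℂ S x ∧ (∀ᶠ z in 𝓝 (x : ℂ), Em z = Ep z * S z) ∧
      adjoint (S x) * S x = 1 ∧ S x * adjoint (S x) = 1 := by
  obtain ⟨m, H, hH, hHE⟩ := hE.exists_inversePoleLE x
  have hEm := hE.differentiable_minus.analyticAt x
  have hEp := hE.differentiable_plus.analyticAt x
  set R : ℂ → X →L[ℂ] X := fun z => Ring.inverse (Ep z) * Em z with hR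
  have hpr : ∀ z : ℂ, 0 < z.im → Em z = Ep z * R z := fun z hz => by
    rw [hR, ← mul_assoc, Ring.mul_inverse_cancel _ (hE.isUnit_plus z hz), one_mul]
  have hHR : ∀ᶠ z in 𝓝 (x : ℂ), 0 < z.im → H z * Em z = (z - x) ^ m • R z := by
    filter_upwards [hHE] with z hz him
    rw [hpr z him, ← mul_assoc, hz.1, smul_mul_assoc, one_mul]
  obtain ⟨S, hS, hSQ⟩ := exists_eq_pow_smul_of_norm_le m (hH.mul hEm) (by
    filter_upwards [hHR.filter_mono nhdsWithin_le_nhds, self_mem_nhdsWithin] with z hz him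
    rw [Pi.mul_apply, hz him, norm_smul, norm_pow]
    exact mul_le_of_le_one_right (by positivity) (hE.inner.norm_le_one z him))
  have hSR : ∀ᶠ z in 𝓝 (x : ℂ), 0 < z.im → R z = S z := by
    filter_upwards [hHR] with z hz him
    have hne : (z - x) ^ m ≠ 0 := by
      refine pow_ne_zero _ (sub_ne_zero.2 ?_)
      rintro rfl
      simp at him
    refine smul_right_injective _ hne ?_
    have := hSQ z
    rw [Pi.mul_apply, hz him] at this
    exact this
  refine ⟨S, hS, ?_, ?_⟩
  · refine (hEm.continuousAt.eventuallyEq_nhds_iff_eventuallyEq_nhdsNE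
      (hEp.continuousAt.mul hS.continuousAt)).1 ?_
    filter_upwards [hHE.filter_mono nhdsWithin_le_nhds, self_mem_nhdsWithin] with z hz hne
    have hne : (z - x) ^ m ≠ 0 := pow_ne_zero _ (sub_ne_zero.2 hne)
    refine smul_right_injective _ hne ?_
    simp only [Pi.mul_apply]
    rw [← mul_smul_comm, ← hSQ, Pi.mul_apply, ← mul_assoc, hz.2, smul_mul_assoc, one_mul]
  · obtain ⟨Sb, hlim, hiso, hcoiso⟩ := hE.inner.boundary
    have hae : ∀ᵐ t : ℝ, (∀ᶠ z in 𝓝 (t : ℂ), 0 < z.im → R z = S z) → ContinuousAt S t →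
        adjoint (S t) * S t = 1 ∧ S t * adjoint (S t) = 1 := by
      filter_upwards [hlim, hiso, hcoiso] with t h1 h2 h3 h4 h5
      have : Sb t = S t := by
        ext u
        refine tendsto_nhds_unique (h1 u) ?_
        have h6 : Tendsto (fun y : ℝ => S (t + y * Complex.I) u) (𝓝[>] 0) (𝓝 (S t u)) := by
          have := h5.tendsto.comp ((tendsto_vertical t).mono_right nhdsWithin_le_nhds)
          exact ((ContinuousLinearMap.apply ℂ X u).continuous.tendsto _).comp this
        refine h6.congr' ?_
        filter_upwards [((tendsto_vertical t).mono_right nhdsWithin_le_nhds).eventually h4,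
          self_mem_nhdsWithin] with y hy hy0
        have hy0 : 0 < y := hy0
        exact congr($((hy (by simpa using hy0)).symm) u)
      rw [← this]
      exact ⟨h2, h3⟩
    have hcoe : Tendsto ((↑) : ℝ → ℂ) (𝓝 x) (𝓝 (x : ℂ)) :=
      Complex.continuous_ofReal.continuousAt
    have hfreq : ∃ᶠ t : ℝ in 𝓝 x,
        adjoint (S t) * S t = 1 ∧ S t * adjoint (S t) = 1 := by
      have hd := mem_closure_iff_frequently.1 (Measure.dense_of_ae hae x)
      refine (hd.and_eventually ((hcoe.eventually (eventually_eventually_nhds.2 hSR)).and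
        (hcoe.eventually hS.eventually_continuousAt))).mono fun t ht => ?_
      exact ht.1 ht.2.1 ht.2.2
    have hSx : Tendsto (fun t : ℝ => S t) (𝓝 x) (𝓝 (S x)) := hS.continuousAt.tendsto.comp hcoe
    have hSx' : Tendsto (fun t : ℝ => adjoint (S t)) (𝓝 x) (𝓝 (adjoint (S x))) :=
      (adjoint.continuous.tendsto _).comp hSx
    exact ⟨isClosed_singleton.mem_of_frequently_of_tendsto (hfreq.mono fun t h => h.1)
      (hSx'.mul hSx), isClosed_singleton.mem_of_frequently_of_tendsto
      (hfreq.mono fun t h => h.2) (hSx.mul hSx')⟩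

/-! ### The factorization -/

theorem ae_not_of_forall_eventually {p : ℝ → Prop}
    (h : ∀ x, ∀ᶠ t in 𝓝[≠] x, ¬ p t) : ∀ᵐ t : ℝ, ¬ p t := by
  have : {t | p t} = ⋃ R : ℕ, {t | p t ∧ |t| ≤ R} := by
    ext t
    simp only [Set.mem_iUnion, Set.mem_ofPred_eq]
    exact ⟨fun ht => (exists_nat_ge |t|).imp fun _ hn => ⟨ht, hn⟩, fun ⟨_, ht, _⟩ => ht⟩
  rw [ae_iff]
  simp only [not_not]
  rw [this]
  exact (Set.countable_iUnion fun R : ℕ =>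
    (finite_setOf_abs_le_of_forall_eventually h R).countable).measure_zero _

/-- The factorization of a de Branges operator into a Weierstrass product and a de Branges operator that
is invertible on the real line. The last identity says that `Ep₀⁻¹ Em₀` is co-isometric there. -/
theorem IsDeBrangesOperator.exists_factorization {Em Ep : ℂ → X →L[ℂ] X}
    (hE : IsDeBrangesOperator Em Ep) :
    ∃ N Em₀ Ep₀ : ℂ → X →L[ℂ] X, Differentiable ℂ N ∧
      (∃ z₀ : ℝ, IsWeierstrassProduct (z₀ : ℂ) N) ∧ (∀ z : ℂ, z.im ≠ 0 → IsUnit (N z)) ∧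
      (∀ᵐ t : ℝ, IsUnit (N t)) ∧
      (∀ z, Ep z = N z * Ep₀ z) ∧ (∀ z, Em z = N z * Em₀ z) ∧ IsDeBrangesOperator Em₀ Ep₀ ∧
      (∀ x : ℝ, IsUnit (Ep₀ x) ∧ IsUnit (Em₀ x)) ∧
      ∀ x : ℝ, Ep₀ x * adjoint (Ep₀ x) = Em₀ x * adjoint (Em₀ x) := by
  classical
  obtain ⟨N, Ep₀, hN, hEp₀, hW, hNu, hfac, hreal⟩ :=
    exists_weierstrassProduct_mul hE.differentiable_plus hE.fredholm_plus fun x => by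
      obtain ⟨m, hm⟩ := hE.exists_inversePoleLE x
      exact hm.eventually_isUnit.frequently.filter_mono nhdsWithin_le_nhds
  have hNx : ∀ x : ℝ, ∀ᶠ z in 𝓝[≠] (x : ℂ), IsUnit (N z) := by
    intro x
    obtain ⟨m, hm⟩ := hE.exists_inversePoleLE x
    have h0 : ∀ᶠ z in 𝓝 (x : ℂ), IsUnit (Ep₀ z) :=
      hEp₀.continuous.continuousAt.eventually (Units.isOpen.mem_nhds (hreal x))
    filter_upwards [hm.eventually_isUnit, h0.filter_mono nhdsWithin_le_nhds] with z h1 ⟨u, hu⟩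
    rw [hfac, ← hu] at h1
    exact (Units.isUnit_mul_units _ u).1 h1
  choose S hS hES hS1 hS2 using hE.exists_analyticAt
  have hSu : ∀ x : ℝ, IsUnit (S x x) := fun x => ⟨⟨_, _, hS2 x, hS1 x⟩, rfl⟩
  -- where `N` is not invertible, `Ep₀ * S` supplies the value that makes `N⁻¹ * Em` entire
  let Em₀ : ℂ → X →L[ℂ] X := fun z =>
    if IsUnit (N z) then Ring.inverse (N z) * Em z else Ep₀ z * S z.re z
  have hEm₀u : ∀ z, IsUnit (N z) → Em₀ z = Ring.inverse (N z) * Em z := fun z hz => if_pos hz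
  have hloc : ∀ x : ℝ, ∀ᶠ z in 𝓝 (x : ℂ), Em₀ z = Ep₀ z * S x z := by
    intro x
    filter_upwards [hES x, eventually_nhdsWithin_iff.1 (hNx x)] with z hz hz'
    by_cases h : IsUnit (N z)
    · rw [hEm₀u z h, hz, hfac, mul_assoc, ← mul_assoc, Ring.inverse_mul_cancel _ h, one_mul]
    · have : z = x := by
        by_contra hne
        exact h (hz' hne)
      subst this
      simp only [Em₀, if_neg h, Complex.ofReal_re]
  have hEm₀x : ∀ x : ℝ, Em₀ x = Ep₀ x * S x x := fun x => (hloc x).self_of_nhds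
  have hfacm : ∀ z, Em z = N z * Em₀ z := by
    intro z
    by_cases h : IsUnit (N z)
    · rw [hEm₀u z h, ← mul_assoc, Ring.mul_inverse_cancel _ h, one_mul]
    · obtain ⟨x, rfl⟩ : ∃ x : ℝ, (x : ℂ) = z := ⟨z.re, by
        by_contra hne
        exact h (hNu z fun h0 => hne (Complex.ext rfl h0.symm))⟩
      rw [hEm₀x, ← mul_assoc, ← hfac]
      exact (hES x).self_of_nhds
  have hunits : ∀ x : ℝ, IsUnit (Ep₀ x) ∧ IsUnit (Em₀ x) := fun x =>
    ⟨hreal x, by rw [hEm₀x]; exact (hreal x).mul (hSu x)⟩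
  have hreal_or : ∀ z : ℂ, (∃ x : ℝ, (x : ℂ) = z) ∨ z.im ≠ 0 := fun z => by
    by_cases h : z.im = 0
    · exact Or.inl ⟨z.re, Complex.ext rfl h.symm⟩
    · exact Or.inr h
  have hEp₀u : ∀ z, IsUnit (N z) → Ep₀ z = Ring.inverse (N z) * Ep z := fun z hz => by
    rw [hfac, ← mul_assoc, Ring.inverse_mul_cancel _ hz, one_mul]
  have hEm₀d : Differentiable ℂ Em₀ := by
    intro z
    rcases hreal_or z with ⟨x, rfl⟩ | hz
    · exact (hEp₀.differentiableAt.mul (hS x).differentiableAt).congr_of_eventuallyEq (hloc x)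
    · obtain ⟨u, hu⟩ := hNu z hz
      have h1 : DifferentiableAt ℂ (fun z => Ring.inverse (N z) * Em z) z := by
        refine DifferentiableAt.mul ?_ hE.differentiable_minus.differentiableAt
        exact ((hu ▸ analyticAt_inverse u : AnalyticAt ℂ Ring.inverse (N z))).differentiableAt.comp
          z hN.differentiableAt
      refine h1.congr_of_eventuallyEq ?_
      filter_upwards [hN.continuous.continuousAt.eventually
        (Units.isOpen.mem_nhds (hNu z hz))] with w hw using hEm₀u w hw
  have hup : ∀ z : ℂ, 0 < z.im → IsUnit (Ep₀ z) := fun z hz => by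
    have := hNu z hz.ne'
    rw [hEp₀u z this]
    exact (isUnit_ringInverse.2 this).mul (hE.isUnit_plus z hz)
  have hdown : ∀ z : ℂ, z.im < 0 → IsUnit (Em₀ z) := fun z hz => by
    have := hNu z hz.ne
    rw [hEm₀u z this]
    exact (isUnit_ringInverse.2 this).mul (hE.isUnit_minus z hz)
  have hinner : ∀ z : ℂ, 0 < z.im →
      Ring.inverse (Ep₀ z) * Em₀ z = Ring.inverse (Ep z) * Em z := fun z hz => by
    have hu := hNu z hz.ne'
    rw [hfac, hfacm, ringInverse_mul hu (hup z hz), mul_assoc, ← mul_assoc (Ring.inverse (N z)),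
      Ring.inverse_mul_cancel _ hu, one_mul]
  refine ⟨N, Em₀, Ep₀, hN, hW, hNu, ?_, hfac, hfacm, ⟨hEm₀d, hEp₀, fun z => ?_, fun z => ?_, hup,
    hdown, ?_, ?_, ?_⟩, hunits, fun x => ?_⟩
  · have := ae_not_of_forall_eventually (p := fun t => ¬ IsUnit (N (t : ℂ))) fun x => by
      simpa using (tendsto_ofReal_nhdsNE x).eventually (hNx x)
    simpa using this
  · rcases hreal_or z with ⟨x, rfl⟩ | hz
    · exact isFredholm_of_isUnit (hunits x).2
    · rw [hEm₀u z (hNu z hz)]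
      exact isFredholm_mul (isFredholm_of_isUnit (isUnit_ringInverse.2 (hNu z hz)))
        (hE.fredholm_minus z)
  · rcases hreal_or z with ⟨x, rfl⟩ | hz
    · exact isFredholm_of_isUnit (hunits x).1
    · rw [hEp₀u z (hNu z hz)]
      exact isFredholm_mul (isFredholm_of_isUnit (isUnit_ringInverse.2 (hNu z hz)))
        (hE.fredholm_plus z)
  · exact hE.inner.differentiableOn.congr fun z hz => hinner z hz
  · intro z hz
    rw [hinner z hz]
    exact hE.inner.norm_le_one z hz
  · obtain ⟨Sb, h1, h2⟩ := hE.inner.boundary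
    refine ⟨Sb, ?_, h2⟩
    filter_upwards [h1] with x hx u
    refine (hx u).congr' ?_
    filter_upwards [self_mem_nhdsWithin] with y hy
    have hy : 0 < y := hy
    rw [hinner _ (by simpa using hy)]
  · rw [hEm₀x, show adjoint (Ep₀ x * S x x) = adjoint (S x x) * adjoint (Ep₀ x) from
      adjoint_comp _ _, mul_assoc, ← mul_assoc (S x x), hS2, one_mul]

end

section

variable {X : Type*} [NormedAddCommGroup X] [InnerProductSpace ℂ X] [CompleteSpace X]

/-! ### The reproducing kernels -/

/-- The reflected family `z ↦ E(z̄)*` is entire, so an identity between `E z * E(z̄)*` of two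
families propagates from the real line to the whole plane. -/
theorem mul_adjoint_star_eq {Em Ep : ℂ → X →L[ℂ] X} (hm : Differentiable ℂ Em)
    (hp : Differentiable ℂ Ep) (h : ∀ x : ℝ, Ep x * adjoint (Ep x) = Em x * adjoint (Em x))
    (z : ℂ) : Ep z * adjoint (Ep (star z)) = Em z * adjoint (Em (star z)) := by
  have hrefl : ∀ E : ℂ → X →L[ℂ] X, Differentiable ℂ E →
      Differentiable ℂ fun z => adjoint (E (star z)) := fun E hE z => by
    have := (hE (star z)).star_star
    rw [star_star] at this
    exact this
  have h1 : AnalyticOnNhd ℂ (fun z => Ep z * adjoint (Ep (star z))) Set.univ := fun z _ =>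
    (hp.mul (hrefl Ep hp)).analyticAt z
  have h2 : AnalyticOnNhd ℂ (fun z => Em z * adjoint (Em (star z))) Set.univ := fun z _ =>
    (hm.mul (hrefl Em hm)).analyticAt z
  have hfr : ∃ᶠ z in 𝓝[≠] (0 : ℂ),
      Ep z * adjoint (Ep (star z)) = Em z * adjoint (Em (star z)) := by
    have : ∃ᶠ t : ℝ in 𝓝[≠] (0 : ℝ), Ep (t : ℂ) * adjoint (Ep (star (t : ℂ))) =
        Em (t : ℂ) * adjoint (Em (star (t : ℂ))) := by
      refine (Eventually.of_forall fun t => ?_).frequently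
      have : star (t : ℂ) = t := Complex.conj_ofReal t
      rw [this, h]
    simpa using (tendsto_ofReal_nhdsNE 0).frequently this
  exact congr_fun (h1.eq_of_frequently_eq h2 hfr) z

/-- Both cases of the definition of the kernel in one formula: the numerator vanishes for `z = star w`,
and the kernel is a combination of difference quotients of `Ep` and `Em`. -/
theorem kernel_eq_dslope {Em Ep : ℂ → X →L[ℂ] X}
    (h : ∀ z, Ep z * adjoint (Ep (star z)) = Em z * adjoint (Em (star z))) (z w : ℂ) :
    kernel Em Ep z w = (-2 * Real.pi * Complex.I : ℂ)⁻¹ •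
      (dslope Ep (star w) z * adjoint (Ep w) - dslope Em (star w) z * adjoint (Em w)) := by
  by_cases hz : z = star w
  · subst hz
    simp [kernel, dslope_same]
  · have hne : z - star w ≠ 0 := sub_ne_zero.2 hz
    have h0 := h (star w)
    rw [star_star] at h0
    simp only [kernel, Matrix.of_apply, if_neg hz]
    rw [dslope_of_ne _ hz, dslope_of_ne _ hz, slope, slope, mul_inv, mul_smul]
    congr 1
    simp only [vsub_eq_sub, smul_mul_assoc, ← smul_sub, sub_mul, h0]
    congr 1
    abel

theorem kernel_mul {N Em Ep Em₀ Ep₀ : ℂ → X →L[ℂ] X} (hN : Differentiable ℂ N)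
    (hm : Differentiable ℂ Em₀) (hp : Differentiable ℂ Ep₀)
    (h : ∀ z, Ep₀ z * adjoint (Ep₀ (star z)) = Em₀ z * adjoint (Em₀ (star z)))
    (hfp : ∀ z, Ep z = N z * Ep₀ z) (hfm : ∀ z, Em z = N z * Em₀ z) (z w : ℂ) :
    kernel Em Ep z w = N z * kernel Em₀ Ep₀ z w * adjoint (N w) := by
  have hadj : ∀ A B : X →L[ℂ] X, adjoint (A * B) = adjoint B * adjoint A := adjoint_comp
  obtain rfl : Ep = N * Ep₀ := funext hfp
  obtain rfl : Em = N * Em₀ := funext hfm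
  by_cases hz : z = star w
  · subst hz
    have h0 := h (star w)
    rw [star_star] at h0
    simp only [kernel, Matrix.of_apply, if_pos, Pi.mul_apply]
    rw [deriv_mul (hN _) (hp _), deriv_mul (hN _) (hm _), hadj, hadj, mul_smul_comm,
      smul_mul_assoc]
    congr 1
    -- the derivative of `N` drops out because of `h`
    simp only [add_mul, mul_sub, sub_mul, mul_assoc]
    rw [← mul_assoc (Ep₀ _) (adjoint (Ep₀ w)), ← mul_assoc (Em₀ _) (adjoint (Em₀ w)), h0]
    abel
  · simp only [kernel, Matrix.of_apply, if_neg hz, Pi.mul_apply, hadj]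
    rw [mul_smul_comm, smul_mul_assoc]
    congr 1
    simp only [mul_sub, sub_mul, mul_assoc]

theorem tendsto_slope_of_hasStrictDerivAt {A : Type*} [NormedAddCommGroup A] [NormedSpace ℂ A]
    {E : ℂ → A} {E' : A} {x : ℂ} (hE : HasStrictDerivAt E E' x) {ι : Type*} {l : Filter ι}
    {u v : ι → ℂ} (hu : Tendsto u l (𝓝 x)) (hv : Tendsto v l (𝓝 x)) (hne : ∀ᶠ i in l, u i ≠ v i) :
    Tendsto (fun i => slope E (u i) (v i)) l (𝓝 E') := by
  have h1 := (hE.hasStrictFDerivAt.isLittleO).comp_tendsto (hv.prodMk_nhds hu)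
  rw [← tendsto_sub_nhds_zero_iff, tendsto_zero_iff_norm_tendsto_zero]
  have h2 := h1.norm_norm.tendsto_div_nhds_zero
  refine h2.congr' ?_
  filter_upwards [hne] with i hi
  have hne : v i - u i ≠ 0 := sub_ne_zero.2 hi.symm
  have : slope E (u i) (v i) - E' = (v i - u i)⁻¹ • (E (v i) - E (u i) - (v i - u i) • E') := by
    rw [slope, vsub_eq_sub, smul_sub _ _ ((v i - u i) • E'), smul_smul, inv_mul_cancel₀ hne, one_smul]
  rw [this, norm_smul, norm_inv, div_eq_inv_mul]
  simp

/-- The kernel is continuous at real points of the diagonal, along points where `z ≠ star w`. -/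
theorem tendsto_kernel {Em Ep : ℂ → X →L[ℂ] X} (hm : Differentiable ℂ Em)
    (hp : Differentiable ℂ Ep)
    (h : ∀ z, Ep z * adjoint (Ep (star z)) = Em z * adjoint (Em (star z))) (x : ℝ)
    {ι : Type*} {l : Filter ι} {u v : ι → ℂ} (hu : Tendsto u l (𝓝 (x : ℂ)))
    (hv : Tendsto v l (𝓝 (x : ℂ))) (hne : ∀ᶠ i in l, star (u i) ≠ v i) :
    Tendsto (fun i => kernel Em Ep (v i) (u i)) l (𝓝 (kernel Em Ep x x)) := by
  have hx : star (x : ℂ) = x := Complex.conj_ofReal x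
  have hsu : Tendsto (fun i => star (u i)) l (𝓝 (x : ℂ)) := by
    have := (continuous_star.tendsto (x : ℂ)).comp hu
    rwa [hx] at this
  have key : ∀ E : ℂ → X →L[ℂ] X, Differentiable ℂ E →
      Tendsto (fun i => dslope E (star (u i)) (v i) * adjoint (E (u i))) l
        (𝓝 (dslope E (star (x : ℂ)) x * adjoint (E x))) := by
    intro E hE
    refine Tendsto.mul ?_ ?_
    · rw [hx, dslope_same]
      refine (tendsto_slope_of_hasStrictDerivAt (hE.analyticAt x).hasStrictDerivAt hsu hv
        hne).congr' ?_
      filter_upwards [hne] with i hi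
      rw [dslope_of_ne _ hi.symm]
    · exact (adjoint.continuous.tendsto _).comp ((hE.continuous.tendsto _).comp hu)
  simp only [kernel_eq_dslope h]
  exact ((key Ep hp).sub (key Em hm)).const_smul _

end

section

variable {X : Type*} [NormedAddCommGroup X] [InnerProductSpace ℂ X] [CompleteSpace X]

/-! ### Multiplication by the factor as an isometry -/

theorem exists_adjoint_apply_eq {T : X →L[ℂ] X} (hT : IsUnit T) (v : X) :
    ∃ u, adjoint T u = v := by
  obtain ⟨q, hq⟩ := hT.star
  refine ⟨(↑q⁻¹ : X →L[ℂ] X) v, ?_⟩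
  have h : adjoint T * (↑q⁻¹ : X →L[ℂ] X) = 1 := by
    rw [← star_eq_adjoint, ← hq, q.mul_inv]
  exact congr($h v)

/-- If the kernels of two reproducing kernel Hilbert spaces are related by
`K z w = N z * K₀ z w * (N w)*`, then multiplication by `N` is isometric, provided the kernel
functions of the first space based at points of invertibility of `N` are total. -/
theorem exists_linearIsometry_of_kernel_eq {Y : Type*} {H₀ H : Type*} [NormedAddCommGroup H₀]
    [InnerProductSpace ℂ H₀] [CompleteSpace H₀] [RKHS ℂ H₀ Y X] [NormedAddCommGroup H]
    [InnerProductSpace ℂ H] [CompleteSpace H] [RKHS ℂ H Y X] {N : Y → X →L[ℂ] X}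
    (hK : ∀ z w, RKHS.kernel H z w = N z * RKHS.kernel H₀ z w * adjoint (N w))
    (hd : ∀ L : Submodule ℂ H₀, IsClosed (L : Set H₀) →
      (∀ w, IsUnit (N w) → ∀ v, RKHS.kerFun H₀ w v ∈ L) → ∀ w v, RKHS.kerFun H₀ w v ∈ L) :
    ∃ T : H₀ →ₗᵢ[ℂ] H, ∀ (f : H₀) (z : Y), T f z = N z (f z) := by
  let A : (Y × X →₀ ℂ) →ₗ[ℂ] H₀ :=
    Finsupp.linearCombination ℂ fun p => RKHS.kerFun H₀ p.1 (adjoint (N p.1) p.2)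
  let B : (Y × X →₀ ℂ) →ₗ[ℂ] H :=
    Finsupp.linearCombination ℂ fun p => RKHS.kerFun H p.1 p.2
  have hinner : ∀ p q : Y × X,
      inner ℂ (RKHS.kerFun H₀ p.1 (adjoint (N p.1) p.2)) (RKHS.kerFun H₀ q.1 (adjoint (N q.1) q.2))
        = inner ℂ (RKHS.kerFun H p.1 p.2) (RKHS.kerFun H q.1 q.2) := by
    intro p q
    rw [← RKHS.kernel_inner, ← RKHS.kernel_inner, hK, adjoint_inner_right]
    rfl
  have hAB : ∀ d, ‖B d‖ = ‖A d‖ := by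
    intro d
    rw [← sq_eq_sq₀ (norm_nonneg _) (norm_nonneg _), ← inner_self_eq_norm_sq (𝕜 := ℂ),
      ← inner_self_eq_norm_sq (𝕜 := ℂ)]
    simp only [A, B, Finsupp.linearCombination_apply, Finsupp.sum_inner, Finsupp.inner_sum,
      inner_smul_left, inner_smul_right, hinner]
  have hAd : DenseRange A := by
    have htop : (LinearMap.range A).topologicalClosure = ⊤ := by
      rw [eq_top_iff, ← RKHS.kerFun_dense H₀]
      refine Submodule.topologicalClosure_minimal _ (Submodule.span_le.2 ?_)
        (Submodule.isClosed_topologicalClosure _)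
      rintro _ ⟨w, v, rfl⟩
      refine hd _ (Submodule.isClosed_topologicalClosure _) (fun w hw v => ?_) w v
      refine Submodule.le_topologicalClosure _ ?_
      obtain ⟨v', rfl⟩ := exists_adjoint_apply_eq hw v
      refine ⟨Finsupp.single (w, v') 1, ?_⟩
      simp only [A, Finsupp.linearCombination_single, one_smul]
    exact Submodule.dense_iff_topologicalClosure_eq_top.2 htop
  have hBd : DenseRange B := by
    have htop : (LinearMap.range B).topologicalClosure = ⊤ := by
      rw [eq_top_iff, ← RKHS.kerFun_dense H]
      refine Submodule.topologicalClosure_mono (Submodule.span_le.2 ?_)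
      rintro _ ⟨w, v, rfl⟩
      exact ⟨Finsupp.single (w, v) 1, by simp [B]⟩
    exact Submodule.dense_iff_topologicalClosure_eq_top.2 htop
  let T := (LinearEquiv.refl ℂ (Y × X →₀ ℂ)).extendOfIsometry A B hAd hBd hAB
  have hT : ∀ w v, T (RKHS.kerFun H₀ w (adjoint (N w) v)) = RKHS.kerFun H w v := by
    intro w v
    have := (LinearEquiv.refl ℂ (Y × X →₀ ℂ)).extendOfIsometry_eq A B hAd hBd hAB
      (Finsupp.single (w, v) 1)
    simpa [A, B] using this
  refine ⟨T.toLinearIsometry, fun f z => ext_inner_left ℂ fun v => ?_⟩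
  have h1 : inner ℂ (T (RKHS.kerFun H₀ z (adjoint (N z) v))) (T f) =
      inner ℂ (RKHS.kerFun H₀ z (adjoint (N z) v)) f := T.inner_map_map _ _
  rw [hT, RKHS.kerFun_inner, RKHS.kerFun_inner, adjoint_inner_left] at h1
  exact h1

theorem tendsto_kerFun {H : Type*} [NormedAddCommGroup H] [InnerProductSpace ℂ H]
    [CompleteSpace H] {Y : Type*} [RKHS ℂ H Y X] {ι : Type*} {l : Filter ι} {u : ι → Y} {x : Y}
    (h₁ : Tendsto (fun i => RKHS.kernel H (u i) (u i)) l (𝓝 (RKHS.kernel H x x)))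
    (h₂ : Tendsto (fun i => RKHS.kernel H x (u i)) l (𝓝 (RKHS.kernel H x x))) (v : X) :
    Tendsto (fun i => RKHS.kerFun H (u i) v) l (𝓝 (RKHS.kerFun H x v)) := by
  have hsq : ∀ i, ‖RKHS.kerFun H (u i) v - RKHS.kerFun H x v‖ ^ 2 =
      RCLike.re (inner ℂ (RKHS.kernel H (u i) (u i) v) v) -
        2 * RCLike.re (inner ℂ (RKHS.kernel H x (u i) v) v) +
        RCLike.re (inner ℂ (RKHS.kernel H x x v) v) := by
    intro i
    rw [norm_sub_sq (𝕜 := ℂ), RKHS.kernel_inner, RKHS.kernel_inner, RKHS.kernel_inner,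
      inner_self_eq_norm_sq, inner_self_eq_norm_sq]
  have happ : ∀ {k : ι → X →L[ℂ] X} {k₀ : X →L[ℂ] X}, Tendsto k l (𝓝 k₀) →
      Tendsto (fun i => RCLike.re (inner ℂ (k i v) v)) l (𝓝 (RCLike.re (inner ℂ (k₀ v) v))) := by
    intro k k₀ hk
    have : Continuous fun T : X →L[ℂ] X => RCLike.re (inner ℂ (T v) v) := by fun_prop
    exact (this.tendsto k₀).comp hk
  have hlim := ((happ h₁).sub ((happ h₂).const_mul 2)).add_const
    (RCLike.re (inner ℂ (RKHS.kernel H x x v) v))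
  simp only [← hsq] at hlim
  rw [tendsto_iff_norm_sub_tendsto_zero]
  have := hlim.sqrt
  simp only [Real.sqrt_sq (norm_nonneg _)] at this
  convert this using 2
  rw [eq_comm, Real.sqrt_eq_zero']
  linarith

/-- Multiplication by `N` is isometric between the reproducing kernel Hilbert spaces of two pairs of
which one is `N` times the other. -/
theorem exists_linearIsometry_mul {N Em Ep Em₀ Ep₀ : ℂ → X →L[ℂ] X} (hN : Differentiable ℂ N)
    (hm : Differentiable ℂ Em₀) (hp : Differentiable ℂ Ep₀)
    (hreal : ∀ x : ℝ, Ep₀ x * adjoint (Ep₀ x) = Em₀ x * adjoint (Em₀ x))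
    (hfp : ∀ z, Ep z = N z * Ep₀ z) (hfm : ∀ z, Em z = N z * Em₀ z)
    (hNu : ∀ z : ℂ, z.im ≠ 0 → IsUnit (N z))
    (H₀ : Type*) [NormedAddCommGroup H₀] [InnerProductSpace ℂ H₀] [CompleteSpace H₀]
    [RKHS ℂ H₀ ℂ X]
    (H : Type*) [NormedAddCommGroup H] [InnerProductSpace ℂ H] [CompleteSpace H]
    [RKHS ℂ H ℂ X] (hH₀ : RKHS.kernel H₀ = kernel Em₀ Ep₀) (hH : RKHS.kernel H = kernel Em Ep) :
    ∃ T : H₀ →ₗᵢ[ℂ] H, ∀ (f : H₀) (z : ℂ), T f z = N z (f z) := by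
  have hsym := mul_adjoint_star_eq hm hp hreal
  refine exists_linearIsometry_of_kernel_eq
    (fun z w => by rw [hH, hH₀]; exact kernel_mul hN hm hp hsym hfp hfm z w)
    fun L hL hw w v => ?_
  by_cases him : w.im = 0
  · obtain ⟨x, rfl⟩ : ∃ x : ℝ, (x : ℂ) = w := ⟨w.re, Complex.ext rfl him.symm⟩
    have hvert := tendsto_vertical x
    have hu : Tendsto (fun y : ℝ => (x : ℂ) + y * Complex.I) (𝓝[>] 0) (𝓝 (x : ℂ)) :=
      hvert.mono_right nhdsWithin_le_nhds
    have hpos : ∀ᶠ y : ℝ in 𝓝[>] 0, 0 < ((x : ℂ) + y * Complex.I).im :=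
      hvert.eventually self_mem_nhdsWithin
    refine hL.mem_of_tendsto (tendsto_kerFun (u := fun y : ℝ => (x : ℂ) + y * Complex.I)
      (l := 𝓝[>] 0) ?_ ?_ v) ?_
    · rw [hH₀]
      refine tendsto_kernel hm hp hsym x hu hu ?_
      filter_upwards [hpos] with y hy h
      have := congr_arg Complex.im h
      rw [Complex.star_def, Complex.conj_im] at this
      linarith
    · rw [hH₀]
      refine tendsto_kernel hm hp hsym x hu tendsto_const_nhds ?_
      filter_upwards [hpos] with y hy h
      have := congr_arg Complex.im h
      rw [Complex.star_def, Complex.conj_im, Complex.ofReal_im] at this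
      linarith
    · filter_upwards [hpos] with y hy using hw _ (hNu _ hy.ne') v
  · exact hw w (hNu w him) v

omit [CompleteSpace X] in
theorem MemHardyUpper.congr {F G : ℂ → X} (hF : MemHardyUpper F)
    (h : ∀ z : ℂ, 0 < z.im → G z = F z) : MemHardyUpper G := by
  obtain ⟨hd, C, hC⟩ := hF
  refine ⟨hd.congr h, C, fun y hy => ?_⟩
  convert hC y hy using 5 with x
  exact h _ (by simpa using hy)

omit [CompleteSpace X] in
theorem MemHardyLower.congr {F G : ℂ → X} (hF : MemHardyLower F)
    (h : ∀ z : ℂ, z.im < 0 → G z = F z) : MemHardyLower G := by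
  obtain ⟨hd, C, hC⟩ := hF
  refine ⟨hd.congr h, C, fun y hy => ?_⟩
  convert hC y hy using 5 with x
  exact h _ (by simpa using hy)

omit [CompleteSpace X] in
theorem ringInverse_mul_apply {N E : X →L[ℂ] X} (hN : IsUnit N) (hE : IsUnit E) (u : X) :
    Ring.inverse (N * E) (N u) = Ring.inverse E u := by
  rw [ringInverse_mul hN hE]
  have h : Ring.inverse E * Ring.inverse N * N = Ring.inverse E := by
    rw [mul_assoc, Ring.inverse_mul_cancel _ hN, mul_one]
  exact congr($h u)

end

end DeBranges

theorem theorem5p2 {X : Type*} [NormedAddCommGroup X] [InnerProductSpace ℂ X] [CompleteSpace X]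
    [TopologicalSpace.SeparableSpace X] (Em Ep : ℂ → X →L[ℂ] X)
    (hE : DeBranges.IsDeBrangesOperator Em Ep) :
    ∃ N Em₀ Ep₀ : ℂ → X →L[ℂ] X,
      -- the factor `N`
      Differentiable ℂ N ∧
      (∃ z₀ : ℝ, DeBranges.IsWeierstrassProduct (z₀ : ℂ) N) ∧
      (∀ z : ℂ, ¬ IsUnit (N z) ↔ z.im = 0 ∧ ¬ IsUnit (Ep z)) ∧
      (∀ z : ℂ, ¬ IsUnit (N z) ↔ z.im = 0 ∧ ¬ IsUnit (Em z)) ∧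
      -- the factorizations
      (∀ z : ℂ, Ep z = N z * Ep₀ z) ∧
      (∀ z : ℂ, Em z = N z * Em₀ z) ∧
      -- the new pair
      DeBranges.IsDeBrangesOperator Em₀ Ep₀ ∧
      (∀ x : ℝ, IsUnit (Ep₀ x) ∧ IsUnit (Em₀ x)) ∧
      -- multiplication by `N` is an isometry between the de Branges spaces, realized through
      -- Hardy spaces with the integral norm
      (∀ f ∈ DeBranges.space Em₀ Ep₀,
        (fun z => N z (f z)) ∈ DeBranges.space Em Ep ∧
        DeBranges.spaceNorm Ep (fun z => N z (f z)) = DeBranges.spaceNorm Ep₀ f) ∧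
      -- the same for the de Branges spaces, realized as the reproducing kernel Hilbert spaces of
      -- the de Branges kernels
      (∀ (H₀ : Type*) [NormedAddCommGroup H₀] [InnerProductSpace ℂ H₀] [CompleteSpace H₀]
        [RKHS ℂ H₀ ℂ X]
        (H : Type*) [NormedAddCommGroup H] [InnerProductSpace ℂ H] [CompleteSpace H]
        [RKHS ℂ H ℂ X],
        RKHS.kernel H₀ = DeBranges.kernel Em₀ Ep₀ → RKHS.kernel H = DeBranges.kernel Em Ep →
        ∃ T : H₀ →ₗᵢ[ℂ] H, ∀ (f : H₀) (z : ℂ), T f z = N z (f z)) := by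
  obtain ⟨N, Em₀, Ep₀, hN, hW, hNu, hNae, hfp, hfm, hE₀, hunit, hreal⟩ := hE.exists_factorization
  have hzero : ∀ E E₀ : ℂ → X →L[ℂ] X, (∀ z, E z = N z * E₀ z) → (∀ x : ℝ, IsUnit (E₀ x)) →
      ∀ z : ℂ, ¬ IsUnit (N z) ↔ z.im = 0 ∧ ¬ IsUnit (E z) := by
    intro E E₀ hf hu z
    by_cases hz : z.im = 0
    · obtain ⟨x, rfl⟩ : ∃ x : ℝ, (x : ℂ) = z := ⟨z.re, Complex.ext rfl hz.symm⟩
      obtain ⟨u, hu⟩ := hu x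
      rw [hf, ← hu, Units.isUnit_mul_units]
      simp
    · simp [hz, hNu z hz]
  refine ⟨N, Em₀, Ep₀, hN, hW, hzero Ep Ep₀ hfp fun x => (hunit x).1,
    hzero Em Em₀ hfm fun x => (hunit x).2, hfp, hfm, hE₀, hunit, ?_, ?_⟩
  · rintro f ⟨hf, hup, hlow⟩
    refine ⟨⟨hN.clm_apply hf, hup.congr fun z hz => ?_, hlow.congr fun z hz => ?_⟩, ?_⟩
    · rw [hfp]
      exact DeBranges.ringInverse_mul_apply (hNu z hz.ne') (hE₀.isUnit_plus z hz) _
    · rw [hfm]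
      exact DeBranges.ringInverse_mul_apply (hNu z hz.ne) (hE₀.isUnit_minus z hz) _
    · refine eLpNorm_congr_ae ?_
      filter_upwards [hNae] with t ht
      rw [hfp]
      exact DeBranges.ringInverse_mul_apply ht (hunit t).1 _
  · intro H₀ _ _ _ _ H _ _ _ _ hH₀ hH
    exact DeBranges.exists_linearIsometry_mul hN hE₀.differentiable_minus hE₀.differentiable_plus
      hreal hfp hfm hNu H₀ H hH₀ hH
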